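/- **Setting.** Consider $\min_{x\in X}\{f(x):=\max_{p\in P}[\sum_{i=1}^m p_if_i(x)-\rho^*(p)]+u(x)\}$, where $X\subseteq\mathbb R^n$ and $P\subseteq\Delta^m_+=\{p\in\mathbb R^m: p\ge 0,\ \sum_i p_i=1\}$ are closed and convex, $u:\mathbb R^n\to(-\infty,\infty]$ and $\rho^*:\mathbb R^m\to(-\infty,\infty]$ are proper, closed and convex with $X\cap\operatorname{dom}u\ne\emptyset$ and $P\cap\operatorname{dom}\rho^*\neq\emptyset$, each $f_i:\mathbb R^n\to\mathbb R$ is convex and differentiable with Lipschitz gradient on $\mathbb R^n$, and $u$ is $\alpha$-strongly convex with $\alpha>0$. Let $L_f>0$ be such that $\nabla\big(\sum_ip_if_i\big)$ is $L_f$-Lipschitz on $\mathbb R^n$ for every $p\in P$ (e.g. $L_f=\max_{p\in P}L_p$ with $L_p$ the Lipschitz constant of $\nabla(\sum_ip_if_i)$, if this is positive), and $\kappa:=L_f/\alpha$. Let $\|\cdot\|_U$ be a norm on $\mathbb R^m$ and $U(p;\bar p)=\omega(p)-\omega(\bar p)-\langle\nabla\omega(\bar p),p-\bar p\rangle$ a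 Bregman distance on $P$, where $\omega$ is differentiable on $P$ and $1$-strongly convex on $P$ with respect to $\|\cdot\|_U$; put $D_P:=\sup_{p,\bar p\in P}\sqrt{2U(p;\bar p)}$, assumed finite. Let $x^*$ be an optimal solution and $R_0\ge\|x^0-x^*\|$. **DRAO-S.** Put $x^{-1}=x^0=\underline x^0\in X$. In phase $t=1,2,\dots$ set $\tilde x^t=x^{t-1}+\theta_t(x^{t-1}-x^{t-2})$, $\underline x^t=(\tilde x^t+\tau_t\underline x^{t-1})/(1+\tau_t)$, $v_i^t=\nabla f_i(\underline x^t)$, $c_i^t=\langle\underline x^t,v_i^t\rangle-f_i(\underline x^t)$ (which is $f_i^*(v_i^t)$), and $M_t=\max\{\sum_ip_i\langle v_i^t,y\rangle:\|p\|_U\le1,\|y\|\le1\}$. Then, for $s=1,\dots,S_t$, put $\tilde v^s=\sum_ip_i^{s-1}v_i^t+\delta_s^t\sum_i(p_i^{s-1}-p_i^{s-2})w_i$ with $w_i=v_i^{t-1}$ if $s=1$ and $w_i=v_i^t$ if $s\ge2$ (where $v^0:=v^1$), and $$y^s=\operatorname*{argmin}_{y\in X}\ \langle y,\tilde v^s\rangle+u(y)+\tfrac{\beta_s^t}2\|y-y^{s-1}\|^2+\tfrac{\eta_t}2\|y-x^{t-1}\|^2,$$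 $$p^s=\operatorname*{argmax}_{p\in P}\ \sum_ip_i(\langle v_i^t,y^s\rangle-c_i^t)-\rho^*(p)-\gamma_s^tU(p;p^{s-1}).$$ In phase $1$, $y^0=x^0$ and $p^{-1}=p^0\in P$; in phase $t\ge2$, $(y^0,p^0,p^{-1})$ is $(y^{S_{t-1}},p^{S_{t-1}},p^{S_{t-1}-1})$ of the preceding phase. The phase returns $x^t=\sum_{s=1}^{S_t}q_s^ty^s/\sum_{s=1}^{S_t}q_s^t$. Each inner iteration uses one $P$-projection (the $p$-update). **Stepsizes.** Let $\Delta>0$ and $$\theta_t=\theta:=\tfrac{\sqrt{8\kappa+1}-1}{\sqrt{8\kappa+1}+1},\quad w_t=\theta^{-(t-1)},\quad \tau_t=\tfrac{\sqrt{8\kappa+1}-1}2,\quad \eta_t=\eta:=\tfrac{\alpha(\sqrt{8\kappa+1}-1)}4,$$ $$\beta_s^t=\tfrac{\alpha(s-1)}4,\quad \gamma_s^t=\tfrac{2S_t(S_t+1)}{w_t\alpha s\Delta},\quad \delta_s^t=\tfrac{s-1}s,\quad q_s^t=s,\quad S_t=\max\{1,\lceil\sqrt{2w_t\Delta}\,M_t\rceil\}.$$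 **Theorem.** Under these assumptions the iterates of DRAO-S satisfy $$\|x^N-x^*\|^2\le\theta^N\Big((1+2\kappa)\|x^0-x^*\|^2+\frac{4D_P^2}{\alpha\eta\Delta}\Big)\qquad\text{for all }N\ge1,$$ and there is $\tilde M$ with $M_t\le\tilde M$ for all $t\ge1$. Moreover there is an absolute constant $C>0$ such that, if in addition $\Delta=2D_P^2/(\eta L_fR_0^2)$ and $\kappa\ge1$, then for every such $\tilde M$ and every $\varepsilon\in(0,\tfrac12]$ with $\varepsilon\kappa R_0^2\le1$, some iterate $x^N$ with $\|x^N-x^*\|^2\le\varepsilon$ is reached with a total number of $P$-projections $$\sum_{t=1}^NS_t\le C\Big(\frac{\kappa^{1/4}\tilde MD_P}{\alpha\sqrt\varepsilon}+\sqrt\kappa\,\log\frac1\varepsilon\Big).$$ -/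

import Mathlib

open scoped BigOperators

noncomputable section

namespace DRAOS

/-- The decision space `ℝⁿ` with its Euclidean norm. -/
abbrev Vec (n : ℕ) : Type := EuclideanSpace ℝ (Fin n)

/-- The space `ℝᵐ` of weights; the norm `‖·‖_U` on it is passed separately as a seminorm. -/
abbrev Wt (m : ℕ) : Type := Fin m → ℝ

section ExtendedConvex

variable {E : Type*}

/-- The epigraph of an extended-real-valued function. -/
def epi (g : E → EReal) : Set (E × ℝ) := {z | g z.1 ≤ (z.2 : EReal)}

/-- Proper, closed (lower semicontinuous) and convex, for `g : E → ℝ ∪ {+∞}`. -/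
structure ProperClosedConvex [AddCommGroup E] [Module ℝ E] [TopologicalSpace E]
    (g : E → EReal) : Prop where
  ne_bot : ∀ x, g x ≠ ⊥
  exists_ne_top : ∃ x, g x ≠ ⊤
  convex : Convex ℝ (epi g)
  closed : IsClosed (epi g)

/-- `g` is `α`-strongly convex: `g - (α/2)‖·‖²` is convex, i.e. has a convex epigraph. -/
def StronglyConvex [NormedAddCommGroup E] [Module ℝ E] (α : ℝ) (g : E → EReal) : Prop :=
  Convex ℝ {z : E × ℝ | g z.1 ≤ ((z.2 + α / 2 * ‖z.1‖ ^ 2 : ℝ) : EReal)}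

end ExtendedConvex

/-- The data of `min_{x ∈ X} { max_{p ∈ P} ∑ pᵢ fᵢ(x) - ρ*(p) + u(x) }`. -/
structure RiskProblem (n m : ℕ) where
  /-- feasible set -/
  X : Set (Vec n)
  /-- ambiguity set -/
  P : Set (Wt m)
  /-- scenario cost functions -/
  f : Fin m → Vec n → ℝ
  /-- regularizer -/
  u : Vec n → EReal
  /-- the convex conjugate `ρ*` of the risk measure -/
  rho : Wt m → EReal

namespace RiskProblem

variable {n m : ℕ} (pb : RiskProblem n m)

/-- The aggregate cost `f_p = ∑ pᵢ fᵢ`. -/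
def agg (p : Wt m) (x : Vec n) : ℝ := ∑ i, p i * pb.f i x

/-- The objective function `f(x) = max_{p ∈ P} { ∑ pᵢ fᵢ(x) - ρ*(p) } + u(x)`. -/
def obj (x : Vec n) : EReal :=
  (⨆ p ∈ pb.P, ((pb.agg p x : ℝ) : EReal) - pb.rho p) + pb.u x

/-- `x` is an optimal solution. -/
def IsOptimal (x : Vec n) : Prop := x ∈ pb.X ∧ ∀ z ∈ pb.X, pb.obj x ≤ pb.obj z

/-- The standing assumptions on a smooth risk-averse problem. -/
structure IsSmooth : Prop where
  X_closed : IsClosed pb.X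
  X_convex : Convex ℝ pb.X
  P_closed : IsClosed pb.P
  P_convex : Convex ℝ pb.P
  P_subset : pb.P ⊆ stdSimplex ℝ (Fin m)
  f_convex : ∀ i, ConvexOn ℝ Set.univ (pb.f i)
  f_diff : ∀ i, Differentiable ℝ (pb.f i)
  f_smooth : ∀ i, ∃ L : ℝ, ∀ x z,
    ‖gradient (pb.f i) x - gradient (pb.f i) z‖ ≤ L * ‖x - z‖
  u_pcc : ProperClosedConvex pb.u
  rho_pcc : ProperClosedConvex pb.rho
  /-- some feasible point has finite `u` -/
  X_dom : ∃ x ∈ pb.X, pb.u x ≠ ⊤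
  /-- some admissible weight vector has finite `ρ*` -/
  P_dom : ∃ p ∈ pb.P, pb.rho p ≠ ⊤

/-- `L` is an aggregate smoothness constant: every `f_p`, `p ∈ P`, has an `L`-Lipschitz gradient.
The least such `L` is `max_{p ∈ P} L_p` with `L_p` the Lipschitz constant of `∇f_p`. -/
def AggSmooth (L : ℝ) : Prop :=
  ∀ p ∈ pb.P, ∀ x z, ‖gradient (pb.agg p) x - gradient (pb.agg p) z‖ ≤ L * ‖x - z‖

end RiskProblem

section Bregman

variable {m : ℕ}

/-- The Bregman distance on `P` generated by `ω`:
`U(p; q) = ω(p) - ω(q) - ⟨ω'(q), p - q⟩`. For `p, q` in a convex set `P` on which `ω` is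
differentiable, `⟨ω'(q), p - q⟩` is the one-sided derivative of `ω` at `q` in the direction `p - q`,
so that the value does not depend on which derivative within `P` is taken. -/
def bregman (P : Set (Wt m)) (ω : Wt m → ℝ) (p q : Wt m) : ℝ :=
  ω p - ω q - fderivWithin ℝ ω P q (p - q)

/-- The value of `bregman` does not depend on the derivative within `P` that is used. -/
theorem bregman_eq {P : Set (Wt m)} (hP : Convex ℝ P) {ω : Wt m → ℝ} {p q : Wt m}
    (hp : p ∈ P) (hq : q ∈ P) {A : Wt m →L[ℝ] ℝ} (hA : HasFDerivWithinAt ω A P q) :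
    bregman P ω p q = ω p - ω q - A (p - q) := by
  have h := hA.differentiableWithinAt.hasFDerivWithinAt.unique_on hA
    (mem_tangentConeAt_of_segment_subset (hP.segment_subset hq hp))
  unfold bregman
  rw [h]

/-- The set of all `√(2 U(p; q))`, `p, q ∈ P`. -/
def bregmanDists (P : Set (Wt m)) (ω : Wt m → ℝ) : Set ℝ :=
  {d | ∃ p ∈ P, ∃ q ∈ P, d = Real.sqrt (2 * bregman P ω p q)}

/-- The radius `D_P = sup_{p, q ∈ P} √(2 U(p; q))`. -/
def radius (P : Set (Wt m)) (ω : Wt m → ℝ) : ℝ := sSup (bregmanDists P ω)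

/-- `ω` is an admissible distance generating function on `P` for the norm `N = ‖·‖_U`: it is
differentiable on `P`, is `1`-strongly convex on `P` with respect to `N`, and `D_P` is finite. -/
structure IsDistGen (P : Set (Wt m)) (N : Seminorm ℝ (Wt m)) (ω : Wt m → ℝ) : Prop where
  norm_def : ∀ p, N p = 0 → p = 0
  diff : DifferentiableOn ℝ ω P
  strong : ∀ p ∈ P, ∀ q ∈ P, N (p - q) ^ 2 / 2 ≤ bregman P ω p q
  bdd : BddAbove (bregmanDists P ω)

/-- The operator norm `‖v‖_{2,U*} = max { ∑ pᵢ ⟨vᵢ, y⟩ : ‖p‖_U ≤ 1, ‖y‖ ≤ 1 }`. -/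
def opNorm {n : ℕ} (N : Seminorm ℝ (Wt m)) (v : Fin m → Vec n) : ℝ :=
  sSup {r | ∃ p : Wt m, N p ≤ 1 ∧ ∃ y : Vec n, ‖y‖ ≤ 1 ∧ r = ∑ i, p i * inner ℝ (v i) y}

end Bregman

/-- The stepsizes of DRAO-S. The index `t ≥ 1` is the phase, `s ≥ 1` the inner iteration. -/
structure Stepsizes where
  /-- extrapolation parameter of the outer loop -/
  theta : ℕ → ℝ
  /-- dual stepsize of the outer loop -/
  tau : ℕ → ℝ
  /-- primal stepsize of the outer loop -/
  eta : ℕ → ℝ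
  /-- inner extrapolation parameters `δ_s^t` -/
  delta : ℕ → ℕ → ℝ
  /-- inner stepsizes `γ_s^t` -/
  gamma : ℕ → ℕ → ℝ
  /-- inner stepsizes `β_s^t` -/
  beta : ℕ → ℕ → ℝ
  /-- inner averaging weights `q_s^t` -/
  q : ℕ → ℕ → ℝ
  /-- inner iteration numbers `S_t` -/
  S : ℕ → ℕ

/-- The iterates of DRAO-S: `x t` is `xᵗ`, and `y t s`, `p t s` are the inner iterates
`yˢ`, `pˢ` (`0 ≤ s ≤ S_t`) of phase `t ≥ 1`. -/
structure Iterates (n m : ℕ) where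
  x : ℕ → Vec n
  y : ℕ → ℕ → Vec n
  p : ℕ → ℕ → Wt m

namespace Iterates

variable {n m : ℕ} (it : Iterates n m) (pb : RiskProblem n m) (st : Stepsizes)

/-- The extrapolated point `x̃ᵗ = xᵗ⁻¹ + θ_t (xᵗ⁻¹ - xᵗ⁻²)`, `t ≥ 1`. For `t = 1` the truncated
subtraction gives `xᵗ⁻² = x⁰`, which is the convention `x⁻¹ = x⁰`. -/
def xtil (t : ℕ) : Vec n := it.x (t - 1) + st.theta t • (it.x (t - 1) - it.x (t - 2))

/-- The points where gradients are evaluated: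
`x̲⁰ = x⁰`, `x̲ᵗ = (x̃ᵗ + τ_t x̲ᵗ⁻¹) / (1 + τ_t)`. -/
def xund : ℕ → Vec n
  | 0 => it.x 0
  | t + 1 => (1 + st.tau (t + 1))⁻¹ • (it.xtil st (t + 1) + st.tau (t + 1) • xund t)

/-- `vᵢᵗ = πᵢᵗ = ∇fᵢ(x̲ᵗ)`. -/
def v (t : ℕ) (i : Fin m) : Vec n := gradient (pb.f i) (it.xund st t)

/-- `fᵢ*(πᵢᵗ) = ⟨x̲ᵗ, πᵢᵗ⟩ - fᵢ(x̲ᵗ)`. -/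
def fconj (t : ℕ) (i : Fin m) : ℝ :=
  inner ℝ (it.xund st t) (it.v pb st t i) - pb.f i (it.xund st t)

/-- `M_t = ‖vᵗ‖_{2,U*}`. -/
def M (N : Seminorm ℝ (Wt m)) (t : ℕ) : ℝ := opNorm N (it.v pb st t)

/-- The gradients of the previous phase, with `v⁰ = v¹`. -/
def vprev (t : ℕ) : Fin m → Vec n := if t = 1 then it.v pb st 1 else it.v pb st (t - 1)

/-- The initial point `p⁻¹` of phase `t`: it is `p⁰` for `t = 1`, and `p^{S-1}` of the previous
phase (`S = S_{t-1}`) otherwise. -/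
def pneg (t : ℕ) : Wt m := if t = 1 then it.p 1 0 else it.p (t - 1) (st.S (t - 1) - 1)

/-- The prediction `ṽˢ` in phase `t`. -/
def vtil (t s : ℕ) : Vec n :=
  if s = 1 then
    ∑ i, it.p t 0 i • it.v pb st t i
      + st.delta t 1 • ∑ i, (it.p t 0 i - it.pneg st t i) • it.vprev pb st t i
  else
    ∑ i, it.p t (s - 1) i • it.v pb st t i
      + st.delta t s • ∑ i, (it.p t (s - 1) i - it.p t (s - 2) i) • it.v pb st t i

/-- The function minimized over `X` in the `y`-update of iteration `s` of phase `t`. -/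
def yObj (t s : ℕ) (y : Vec n) : EReal :=
  ((inner ℝ y (it.vtil pb st t s) + st.beta t s / 2 * ‖y - it.y t (s - 1)‖ ^ 2
      + st.eta t / 2 * ‖y - it.x (t - 1)‖ ^ 2 : ℝ) : EReal) + pb.u y

/-- The negative of the function maximized over `P` in the `p`-update (the `P`-projection) of
iteration `s` of phase `t`. -/
def pObj (ω : Wt m → ℝ) (t s : ℕ) (p : Wt m) : EReal :=
  ((-(∑ i, p i * (inner ℝ (it.v pb st t i) (it.y t s) - it.fconj pb st t i))
      + st.gamma t s * bregman pb.P ω p (it.p t (s - 1)) : ℝ) : EReal) + pb.rho p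

/-- The iterates `it` are generated by the DRAO-S method, applied to the smooth problem `pb` with
stepsizes `st` and Bregman distance generated by `ω`. -/
structure IsGenerated (ω : Wt m → ℝ) : Prop where
  x_init : it.x 0 ∈ pb.X
  y_init : it.y 1 0 = it.x 0
  p_init : it.p 1 0 ∈ pb.P
  y_next : ∀ t, 1 ≤ t → it.y (t + 1) 0 = it.y t (st.S t)
  p_next : ∀ t, 1 ≤ t → it.p (t + 1) 0 = it.p t (st.S t)
  y_mem : ∀ t s, 1 ≤ t → 1 ≤ s → s ≤ st.S t → it.y t s ∈ pb.X
  y_min : ∀ t s, 1 ≤ t → 1 ≤ s → s ≤ st.S t →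
    ∀ y ∈ pb.X, it.yObj pb st t s (it.y t s) ≤ it.yObj pb st t s y
  p_mem : ∀ t s, 1 ≤ t → 1 ≤ s → s ≤ st.S t → it.p t s ∈ pb.P
  p_min : ∀ t s, 1 ≤ t → 1 ≤ s → s ≤ st.S t →
    ∀ p ∈ pb.P, it.pObj pb st ω t s (it.p t s) ≤ it.pObj pb st ω t s p
  x_next : ∀ t, 1 ≤ t → it.x t =
    (∑ s ∈ Finset.Icc 1 (st.S t), st.q t s)⁻¹ •
      ∑ s ∈ Finset.Icc 1 (st.S t), st.q t s • it.y t s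

end Iterates

/-- The number of `P`-projections (one per inner iteration) performed in the first `K` phases. -/
def Stepsizes.projections (st : Stepsizes) (K : ℕ) : ℕ := ∑ t ∈ Finset.Icc 1 K, st.S t

/-- `θ = (√(8κ+1) - 1) / (√(8κ+1) + 1)`. -/
def thetaStr (κ : ℝ) : ℝ := (Real.sqrt (8 * κ + 1) - 1) / (Real.sqrt (8 * κ + 1) + 1)

/-- `η = α (√(8κ+1) - 1) / 4`. -/
def etaStr (α κ : ℝ) : ℝ := α * (Real.sqrt (8 * κ + 1) - 1) / 4

/-- `w_t = (1/θ)^{t-1}`, `t ≥ 1`. -/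
def wStr (κ : ℝ) (t : ℕ) : ℝ := (1 / thetaStr κ) ^ (t - 1)

/-- The stepsizes for the smooth, strongly convex problem, adapted to the operator norms `M_t`.
The iteration number is `S_t = ⌈√(2 w_t Δ) M_t⌉`, but at least one iteration is made (the ceiling
is zero only if all gradients of the phase vanish, when an average of no iterates is undefined). -/
structure IsStrStepsizes (st : Stepsizes) (α κ Δ : ℝ) (M : ℕ → ℝ) : Prop where
  theta_eq : ∀ t, 1 ≤ t → st.theta t = thetaStr κ
  tau_eq : ∀ t, 1 ≤ t → st.tau t = (Real.sqrt (8 * κ + 1) - 1) / 2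
  eta_eq : ∀ t, 1 ≤ t → st.eta t = etaStr α κ
  beta_eq : ∀ t s, 1 ≤ t → 1 ≤ s → st.beta t s = α * ((s : ℝ) - 1) / 4
  gamma_eq : ∀ t s, 1 ≤ t → 1 ≤ s → st.gamma t s =
    2 * (st.S t : ℝ) * ((st.S t : ℝ) + 1) / (wStr κ t * α * (s : ℝ) * Δ)
  delta_eq : ∀ t s, 1 ≤ t → 1 ≤ s → st.delta t s = ((s : ℝ) - 1) / (s : ℝ)
  q_eq : ∀ t s, 1 ≤ t → 1 ≤ s → st.q t s = (s : ℝ)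
  S_eq : ∀ t, 1 ≤ t → st.S t = max 1 ⌈Real.sqrt (2 * wStr κ t * Δ) * M t⌉₊

end DRAOS

end

noncomputable section

namespace DRAOS

section Smooth

variable {E : Type*} [NormedAddCommGroup E] [InnerProductSpace ℝ E] [CompleteSpace E]

theorem hasDerivAt_comp_lineMap {g : E → ℝ} (hg : Differentiable ℝ g) (a b : E) (s : ℝ) :
    HasDerivAt (fun s : ℝ => g (AffineMap.lineMap a b s))
      (inner ℝ (gradient g (AffineMap.lineMap a b s)) (b - a)) s := by
  have h1 := (hg (AffineMap.lineMap a b s)).hasFDerivAt.comp_hasDerivAt s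
    (AffineMap.hasDerivAt_lineMap (a := a) (b := b) (x := s))
  rw [inner_gradient_left]
  exact h1

/-- The first-order characterization of convexity. -/
theorem gradient_inner_add_le {g : E → ℝ} (hc : ConvexOn ℝ Set.univ g)
    (hg : Differentiable ℝ g) (a b : E) : g a + inner ℝ (gradient g a) (b - a) ≤ g b := by
  have hc' : ConvexOn ℝ Set.univ (fun s : ℝ => g (AffineMap.lineMap a b s)) :=
    hc.comp_affineMap (AffineMap.lineMap a b)
  have h := hc'.le_slope_of_hasDerivAt (Set.mem_univ 0) (Set.mem_univ 1) one_pos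
    (hasDerivAt_comp_lineMap hg a b 0)
  simp [slope_def_field, -inner_gradient_left] at h
  linarith

/-- The quadratic upper bound for functions with Lipschitz gradient. -/
theorem le_quadratic_of_lipschitz_gradient {g : E → ℝ} (hg : Differentiable ℝ g) {L : ℝ}
    (hL : ∀ x z, ‖gradient g x - gradient g z‖ ≤ L * ‖x - z‖) (a b : E) :
    g b ≤ g a + inner ℝ (gradient g a) (b - a) + L / 2 * ‖b - a‖ ^ 2 := by
  set h : ℝ → ℝ := fun s => g (AffineMap.lineMap a b s)
    - s * inner ℝ (gradient g a) (b - a) - s ^ 2 * (L / 2 * ‖b - a‖ ^ 2) with hh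
  have hd : ∀ s, HasDerivAt h (inner ℝ (gradient g (AffineMap.lineMap a b s)) (b - a)
      - inner ℝ (gradient g a) (b - a) - 2 * s * (L / 2 * ‖b - a‖ ^ 2)) s := by
    intro s
    have h1 := ((hasDerivAt_comp_lineMap hg a b s).sub
      ((hasDerivAt_id s).mul_const (inner ℝ (gradient g a) (b - a)))).sub
      ((hasDerivAt_pow 2 s).mul_const (L / 2 * ‖b - a‖ ^ 2))
    refine h1.congr_deriv ?_
    simp
  have hanti : AntitoneOn h (Set.Icc 0 1) := by
    refine antitoneOn_of_deriv_nonpos (convex_Icc 0 1)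
      (fun s _ => (hd s).continuousAt.continuousWithinAt)
      (fun s _ => (hd s).differentiableAt.differentiableWithinAt) ?_
    intro s hs
    rw [interior_Icc] at hs
    rw [(hd s).deriv, ← inner_sub_left]
    have h1 := real_inner_le_norm
      (gradient g (AffineMap.lineMap a b s) - gradient g a) (b - a)
    have h2 := hL (AffineMap.lineMap a b s) a
    have h3 : ‖AffineMap.lineMap a b s - a‖ = s * ‖b - a‖ := by
      rw [AffineMap.lineMap_apply, vsub_eq_sub, vadd_eq_add, add_sub_cancel_right, norm_smul,
        Real.norm_of_nonneg hs.1.le]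
    rw [h3] at h2
    have h4 := mul_le_mul_of_nonneg_right h2 (norm_nonneg (b - a))
    nlinarith
  have := hanti (Set.left_mem_Icc.2 zero_le_one) (Set.right_mem_Icc.2 zero_le_one) zero_le_one
  simp [hh, -inner_gradient_left] at this
  linarith

/-- The Bregman distance of a differentiable function on a Hilbert space. -/
def breg (g : E → ℝ) (a b : E) : ℝ := g a - g b - inner ℝ (gradient g b) (a - b)

theorem breg_le {g : E → ℝ} (hg : Differentiable ℝ g) {L : ℝ}
    (hL : ∀ x z, ‖gradient g x - gradient g z‖ ≤ L * ‖x - z‖) (a b : E) :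
    breg g a b ≤ L / 2 * ‖a - b‖ ^ 2 := by
  have := le_quadratic_of_lipschitz_gradient hg hL b a
  unfold breg
  linarith

/-- Co-coercivity of the gradient of a smooth convex function. -/
theorem sq_norm_gradient_sub_le_breg {g : E → ℝ} (hc : ConvexOn ℝ Set.univ g)
    (hg : Differentiable ℝ g) {L : ℝ} (hL0 : 0 < L)
    (hL : ∀ x z, ‖gradient g x - gradient g z‖ ≤ L * ‖x - z‖) (a b : E) :
    ‖gradient g a - gradient g b‖ ^ 2 ≤ 2 * L * breg g a b := by
  set d := gradient g a - gradient g b with hd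
  set z := a - L⁻¹ • d with hz
  have h1 := gradient_inner_add_le hc hg b z
  have h2 := le_quadratic_of_lipschitz_gradient hg hL a z
  have hza : z - a = -(L⁻¹ • d) := by rw [hz]; abel
  have hzb : z - b = (a - b) - L⁻¹ • d := by rw [hz]; abel
  rw [hza, norm_neg, norm_smul, inner_neg_right, inner_smul_right,
    Real.norm_of_nonneg (inv_nonneg.2 hL0.le)] at h2
  rw [hzb, inner_sub_right, inner_smul_right] at h1
  have h3 : inner ℝ (gradient g a) d - inner ℝ (gradient g b) d = ‖d‖ ^ 2 := by
    rw [← inner_sub_left, real_inner_self_eq_norm_sq]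
  have h4 : L⁻¹ * ‖d‖ ^ 2 - L / 2 * (L⁻¹ * ‖d‖) ^ 2 ≤ breg g a b := by
    unfold breg
    rw [← h3] at *
    nlinarith
  have h5 : L⁻¹ * ‖d‖ ^ 2 - L / 2 * (L⁻¹ * ‖d‖) ^ 2 = ‖d‖ ^ 2 / (2 * L) := by
    field_simp
    ring
  rw [h5, div_le_iff₀ (by positivity)] at h4
  linarith

theorem breg_three_point (g : E → ℝ) (a b c : E) :
    inner ℝ (gradient g c - gradient g b) (b - a) = breg g a c - breg g b c - breg g a b := by
  unfold breg
  simp only [inner_sub_left, inner_sub_right]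
  ring

/-- A weighted Young inequality for the inner product against a gradient difference. -/
theorem inner_gradient_sub_le {g : E → ℝ} (hc : ConvexOn ℝ Set.univ g)
    (hg : Differentiable ℝ g) {L : ℝ} (hL0 : 0 < L)
    (hL : ∀ x z, ‖gradient g x - gradient g z‖ ≤ L * ‖x - z‖) (a b d : E) {k : ℝ} (hk : 0 < k) :
    inner ℝ (gradient g a - gradient g b) d ≤ k * breg g a b + L / (2 * k) * ‖d‖ ^ 2 := by
  have h1 := sq_norm_gradient_sub_le_breg hc hg hL0 hL a b
  have h2 := real_inner_le_norm (gradient g a - gradient g b) d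
  set e := ‖gradient g a - gradient g b‖
  have h3 : e * ‖d‖ ≤ k * (e ^ 2 / (2 * L)) + L / (2 * k) * ‖d‖ ^ 2 := by
    have : k * (e ^ 2 / (2 * L)) + L / (2 * k) * ‖d‖ ^ 2 - e * ‖d‖
        = (k * e - L * ‖d‖) ^ 2 / (2 * L * k) := by
      field_simp
      ring
    have h4 : 0 ≤ (k * e - L * ‖d‖) ^ 2 / (2 * L * k) := by positivity
    linarith
  have h4 : e ^ 2 / (2 * L) ≤ breg g a b := by
    rw [div_le_iff₀ (by positivity)]
    linarith
  have := mul_le_mul_of_nonneg_left h4 hk.le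
  linarith

/-- The affine minorant of `g` at `z`, evaluated at `x`. -/
def lin (g : E → ℝ) (z x : E) : ℝ := g z + inner ℝ (gradient g z) (x - z)

/-- The outer dual estimate, telescoped over the phases, before the last cross term is bounded. -/
theorem outer_partial {g : E → ℝ} (hc : ConvexOn ℝ Set.univ g)
    (hg : Differentiable ℝ g) {L : ℝ} (hL0 : 0 < L)
    (hL : ∀ x z, ‖gradient g x - gradient g z‖ ≤ L * ‖x - z‖)
    {x xu : ℕ → E} {τ θ η : ℝ} {W : ℕ → ℝ} (xs : E) (hτ : 0 < τ)
    (hθ : θ * (1 + τ) = τ) (hη : L = η * (1 + τ)) (hW : ∀ t, W (t + 1) * θ = W t)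
    (hW0 : ∀ t, 0 ≤ W t) (h0 : xu 0 = x 0)
    (hxu : ∀ t, (1 + τ) • xu (t + 1) = x t + θ • (x t - x (t - 1)) + τ • xu t) (K : ℕ) :
    ∑ t ∈ Finset.range K, W (t + 1) * (lin g xs (x (t + 1)) - lin g (xu (t + 1)) (x (t + 1)))
      ≤ W 0 * (1 + τ) * breg g (x 0) xs - W K * (1 + τ) * breg g (xu K) xs
        + W K * inner ℝ (gradient g xs - gradient g (xu K)) (x K - x (K - 1))
        + ∑ t ∈ Finset.range K, W t * (η / 2) * ‖x t - x (t - 1)‖ ^ 2 := by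
  induction K with
  | zero => simp [h0]
  | succ t ih =>
    rw [Finset.sum_range_succ, Finset.sum_range_succ, Nat.add_sub_cancel]
    have hstep : lin g xs (x (t + 1)) - lin g (xu (t + 1)) (x (t + 1))
        = inner ℝ (gradient g xs - gradient g (xu (t + 1))) (x (t + 1) - x t)
          - θ * inner ℝ (gradient g xs - gradient g (xu t)) (x t - x (t - 1))
          - θ * inner ℝ (gradient g (xu t) - gradient g (xu (t + 1))) (x t - x (t - 1))
          + τ * breg g (xu t) xs - (1 + τ) * breg g (xu (t + 1)) xs
          - τ * breg g (xu t) (xu (t + 1)) := by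
      have h3 := breg_three_point g (xu t) (xu (t + 1)) xs
      have hx : x t = (1 + τ) • xu (t + 1) - τ • xu t - θ • (x t - x (t - 1)) := by
        rw [hxu]; abel
      have h4 : inner ℝ (gradient g xs - gradient g (xu (t + 1))) (x (t + 1) - x t)
          = inner ℝ (gradient g xs - gradient g (xu (t + 1))) (x (t + 1) - xu (t + 1))
            - τ * inner ℝ (gradient g xs - gradient g (xu (t + 1))) (xu (t + 1) - xu t)
            + θ * inner ℝ (gradient g xs - gradient g (xu (t + 1))) (x t - x (t - 1)) := by
        rw [← inner_smul_right, ← inner_smul_right, ← inner_sub_right, ← inner_add_right]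
        congr 1
        nth_rewrite 1 [hx]
        module
      rw [h4, h3]
      unfold lin breg
      simp only [inner_sub_left, inner_sub_right]
      ring
    have hy := inner_gradient_sub_le hc hg hL0 hL (xu t) (xu (t + 1)) (-(x t - x (t - 1)))
      (k := 1 + τ) (by linarith)
    rw [inner_neg_right, norm_neg] at hy
    have hL2 : L / (2 * (1 + τ)) = η / 2 := by
      rw [hη]; field_simp
    rw [hL2] at hy
    have hk : θ * (1 + τ) = τ := hθ
    have hWt := hW t
    have hnn : 0 ≤ W (t + 1) * θ := by rw [hWt]; exact hW0 t
    have hy2 := mul_le_mul_of_nonneg_left hy hnn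
    rw [hstep]
    set B := breg g (xu t) xs
    set B1 := breg g (xu (t + 1)) xs
    set B2 := breg g (xu t) (xu (t + 1))
    set I1 := inner ℝ (gradient g xs - gradient g (xu (t + 1))) (x (t + 1) - x t)
    set I2 := inner ℝ (gradient g xs - gradient g (xu t)) (x t - x (t - 1))
    set I3 := inner ℝ (gradient g (xu t) - gradient g (xu (t + 1))) (x t - x (t - 1))
    set D := ‖x t - x (t - 1)‖ ^ 2
    have e1 : W t * (1 + τ) = W (t + 1) * τ := by rw [← hWt, mul_assoc, hθ]
    have e2 : W (t + 1) * (I1 - θ * I2 - θ * I3 + τ * B - (1 + τ) * B1 - τ * B2)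
        = W (t + 1) * I1 - W t * I2 - W t * I3 + W t * (1 + τ) * B - W (t + 1) * (1 + τ) * B1
          - W t * (1 + τ) * B2 := by
      rw [e1, ← hWt]; ring
    rw [e2]
    rw [hWt] at hy2
    nlinarith

/-- The outer dual estimate, telescoped over the phases. -/
theorem outer_sum_le {g : E → ℝ} (hc : ConvexOn ℝ Set.univ g)
    (hg : Differentiable ℝ g) {L : ℝ} (hL0 : 0 < L)
    (hL : ∀ x z, ‖gradient g x - gradient g z‖ ≤ L * ‖x - z‖)
    {x xu : ℕ → E} {τ θ η : ℝ} {W : ℕ → ℝ} (xs : E) (hτ : 0 < τ)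
    (hθ : θ * (1 + τ) = τ) (hη : L = η * (1 + τ)) (hW : ∀ t, W (t + 1) * θ = W t)
    (hW0 : ∀ t, 0 ≤ W t) (h0 : xu 0 = x 0)
    (hxu : ∀ t, (1 + τ) • xu (t + 1) = x t + θ • (x t - x (t - 1)) + τ • xu t) (K : ℕ) :
    ∑ t ∈ Finset.range K, W (t + 1) * (lin g xs (x (t + 1)) - lin g (xu (t + 1)) (x (t + 1)))
      ≤ W 0 * (1 + τ) * (L / 2 * ‖x 0 - xs‖ ^ 2)
        + ∑ t ∈ Finset.range K, W (t + 1) * (η / 2) * ‖x (t + 1) - x t‖ ^ 2 := by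
  have h1 := outer_partial hc hg hL0 hL xs hτ hθ hη hW hW0 h0 hxu K
  have hy := inner_gradient_sub_le hc hg hL0 hL (xu K) xs (-(x K - x (K - 1)))
    (k := 1 + τ) (by linarith)
  rw [inner_neg_right, norm_neg, ← inner_neg_left, neg_sub] at hy
  have hL2 : L / (2 * (1 + τ)) = η / 2 := by
    rw [hη]; field_simp
  rw [hL2] at hy
  have hy2 := mul_le_mul_of_nonneg_left hy (hW0 K)
  have hb := mul_le_mul_of_nonneg_left (breg_le hg hL (x 0) xs)
    (mul_nonneg (hW0 0) (by linarith : (0 : ℝ) ≤ 1 + τ))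
  have hs := Finset.sum_range_succ (fun t => W t * (η / 2) * ‖x t - x (t - 1)‖ ^ 2) K
  rw [Finset.sum_range_succ'] at hs
  simp only [Nat.add_sub_cancel, Nat.zero_sub, sub_self, norm_zero, ne_eq, OfNat.ofNat_ne_zero,
    not_false_eq_true, zero_pow, mul_zero, add_zero] at hs
  rw [hs]
  linarith

end Smooth

section Extended

variable {E : Type*}

/-- The points of `S` at which `g` is finite. -/
def finDom (S : Set E) (g : E → EReal) : Set E := {x ∈ S | g x ≠ ⊤}

theorem convexOn_toReal [AddCommGroup E] [Module ℝ E] {g : E → EReal} {S : Set E}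
    (hS : Convex ℝ S) (hb : ∀ x, g x ≠ ⊥) (hc : Convex ℝ (epi g)) :
    ConvexOn ℝ (finDom S g) (fun x => (g x).toReal) := by
  have key : ∀ x ∈ finDom S g, ∀ y ∈ finDom S g, ∀ a b : ℝ, 0 ≤ a → 0 ≤ b → a + b = 1 →
      g (a • x + b • y) ≤ ((a * (g x).toReal + b * (g y).toReal : ℝ) : EReal) := by
    intro x hx y hy a b ha hb' hab
    have h1 : ((x, (g x).toReal) : E × ℝ) ∈ epi g := (EReal.coe_toReal hx.2 (hb x)).ge
    have h2 : ((y, (g y).toReal) : E × ℝ) ∈ epi g := (EReal.coe_toReal hy.2 (hb y)).ge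
    exact hc h1 h2 ha hb' hab
  refine ⟨fun x hx y hy a b ha hb' hab => ⟨hS hx.1 hy.1 ha hb' hab, ?_⟩, ?_⟩
  · exact ne_top_of_le_ne_top (EReal.coe_ne_top _) (key x hx y hy a b ha hb' hab)
  · intro x hx y hy a b ha hb' hab
    have := EReal.toReal_le_toReal (key x hx y hy a b ha hb' hab) (hb _) (EReal.coe_ne_top _)
    simpa only [EReal.toReal_coe, smul_eq_mul] using this

theorem strongConvexOn_toReal [NormedAddCommGroup E] [InnerProductSpace ℝ E] {g : E → EReal}
    {S : Set E} {α : ℝ} (hS : Convex ℝ S) (hb : ∀ x, g x ≠ ⊥) (hc : Convex ℝ (epi g))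
    (hs : StronglyConvex α g) : StrongConvexOn (finDom S g) α (fun x => (g x).toReal) := by
  rw [strongConvexOn_iff_convex]
  refine ⟨(convexOn_toReal hS hb hc).1, ?_⟩
  intro x hx y hy a b ha hb' hab
  have h1 : ((x, (g x).toReal - α / 2 * ‖x‖ ^ 2) : E × ℝ) ∈
      {z : E × ℝ | g z.1 ≤ ((z.2 + α / 2 * ‖z.1‖ ^ 2 : ℝ) : EReal)} := by
    rw [Set.mem_ofPred_eq, sub_add_cancel]
    exact (EReal.coe_toReal hx.2 (hb x)).ge
  have h2 : ((y, (g y).toReal - α / 2 * ‖y‖ ^ 2) : E × ℝ) ∈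
      {z : E × ℝ | g z.1 ≤ ((z.2 + α / 2 * ‖z.1‖ ^ 2 : ℝ) : EReal)} := by
    rw [Set.mem_ofPred_eq, sub_add_cancel]
    exact (EReal.coe_toReal hy.2 (hb y)).ge
  have h3 := hs h1 h2 ha hb' hab
  have h4 := EReal.toReal_le_toReal h3 (hb _) (EReal.coe_ne_top _)
  rw [EReal.toReal_coe] at h4
  simp only [Prod.fst_add, Prod.snd_add, Prod.smul_fst, Prod.smul_snd] at h4
  linarith

/-- A proper closed function is bounded below on a compact set. -/
theorem exists_lower_bound [AddCommGroup E] [Module ℝ E] [TopologicalSpace E] {g : E → EReal}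
    {S : Set E} (hS : IsCompact S) (hg : ProperClosedConvex g) :
    ∃ b : ℝ, ∀ x ∈ S, (b : EReal) ≤ g x := by
  by_contra! h
  choose z hz hzb using fun k : ℕ => h (-(k : ℝ))
  have hcl : ∀ c : ℝ, IsClosed {x | g x ≤ (c : EReal)} := fun c =>
    hg.closed.preimage (f := fun x : E => (x, c)) (by fun_prop)
  have hne : (S ∩ ⋂ k : ℕ, {x | g x ≤ ((-(k : ℝ) : ℝ) : EReal)}).Nonempty := by
    refine hS.inter_iInter_nonempty _ (fun k => hcl _) fun u => ?_
    obtain ⟨K, hK⟩ := u.exists_le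
    refine ⟨z K, hz K, Set.mem_iInter₂.2 fun k hk => (hzb K).le.trans ?_⟩
    have : (k : ℝ) ≤ K := by exact_mod_cast hK k hk
    exact EReal.coe_le_coe_iff.2 (by linarith)
  obtain ⟨x, _, hx⟩ := hne
  refine hg.ne_bot x ((EReal.eq_bot_iff_forall_lt _).2 fun r => ?_)
  obtain ⟨k, hk⟩ := exists_nat_gt (-r)
  exact lt_of_le_of_lt (Set.mem_iInter.1 hx k) (EReal.coe_lt_coe_iff.2 (by linarith))

/-- Minimizers of `φ + g` for finite `φ` are minimizers of the real-valued restriction. -/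
theorem toReal_min {φ : E → ℝ} {g : E → EReal} {S : Set E} (hb : ∀ x, g x ≠ ⊥)
    (hne : ∃ x ∈ S, g x ≠ ⊤) {y : E} (hy : y ∈ S)
    (hmin : ∀ x ∈ S, (φ y : EReal) + g y ≤ (φ x : EReal) + g x) :
    y ∈ finDom S g ∧
      ∀ x ∈ finDom S g, φ y + (g y).toReal ≤ φ x + (g x).toReal := by
  have hyt : g y ≠ ⊤ := by
    obtain ⟨x, hx, hxt⟩ := hne
    intro h
    have := hmin x hx
    rw [h, EReal.coe_add_top, top_le_iff] at this
    exact EReal.add_ne_top (EReal.coe_ne_top _) hxt this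
  refine ⟨⟨hy, hyt⟩, fun x hx => ?_⟩
  have := hmin x hx.1
  rw [← EReal.coe_toReal hyt (hb y), ← EReal.coe_toReal hx.2 (hb x)] at this
  exact_mod_cast this

end Extended

section Prox

/-- Passing to the limit `r → 0` in an inequality that is affine in `r`. -/
theorem le_of_forall_add_mul_le {A B c : ℝ}
    (h : ∀ r : ℝ, 0 < r → r < 1 → A + (1 - r) * c ≤ B) : A + c ≤ B := by
  have ht : Filter.Tendsto (fun r : ℝ => A + (1 - r) * c) (nhdsWithin 0 (Set.Ioi 0))
      (nhds (A + (1 - 0) * c)) :=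
    (Continuous.tendsto (by fun_prop) 0).mono_left nhdsWithin_le_nhds
  have hev : ∀ᶠ r : ℝ in nhdsWithin 0 (Set.Ioi 0), A + (1 - r) * c ≤ B := by
    filter_upwards [Ioo_mem_nhdsGT (zero_lt_one' ℝ)] with r hr using h r hr.1 hr.2
  have := le_of_tendsto ht hev
  linarith

variable {E : Type*} [NormedAddCommGroup E] [InnerProductSpace ℝ E]

/-- Quadratic growth of a strongly convex function at a minimizer. -/
theorem strongConvexOn_min {D : Set E} {μ : ℝ} {F : E → ℝ} (hF : StrongConvexOn D μ F) {y : E}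
    (hy : y ∈ D) (hmin : ∀ x ∈ D, F y ≤ F x) {x : E} (hx : x ∈ D) :
    F y + μ / 2 * ‖y - x‖ ^ 2 ≤ F x := by
  refine le_of_forall_add_mul_le fun r hr0 hr1 => ?_
  have h1 := hF.2 hy hx (by linarith : 0 ≤ 1 - r) hr0.le (by ring)
  have h2 := hmin _ (hF.1 hy hx (by linarith : 0 ≤ 1 - r) hr0.le (by ring))
  simp only [smul_eq_mul] at h1
  have h3 : r * (F y + (1 - r) * (μ / 2 * ‖y - x‖ ^ 2)) ≤ r * F x := by nlinarith
  exact le_of_mul_le_mul_left h3 hr0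

/-- The three-point inequality for a proximal step with two proximal centers. -/
theorem prox_three_point {D : Set E} {α β η : ℝ} {u : E → ℝ} (hu : StrongConvexOn D α u)
    {v a b y : E} (hy : y ∈ D)
    (hmin : ∀ x ∈ D, inner ℝ y v + β / 2 * ‖y - a‖ ^ 2 + η / 2 * ‖y - b‖ ^ 2 + u y
      ≤ inner ℝ x v + β / 2 * ‖x - a‖ ^ 2 + η / 2 * ‖x - b‖ ^ 2 + u x) {x : E} (hx : x ∈ D) :
    inner ℝ y v + β / 2 * ‖y - a‖ ^ 2 + η / 2 * ‖y - b‖ ^ 2 + u y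
        + (α + β + η) / 2 * ‖y - x‖ ^ 2
      ≤ inner ℝ x v + β / 2 * ‖x - a‖ ^ 2 + η / 2 * ‖x - b‖ ^ 2 + u x := by
  refine strongConvexOn_min (D := D)
    (F := fun x => inner ℝ x v + β / 2 * ‖x - a‖ ^ 2 + η / 2 * ‖x - b‖ ^ 2 + u x) ?_ hy hmin hx
  rw [strongConvexOn_iff_convex] at hu ⊢
  have haff : ConvexOn ℝ D (fun x => inner ℝ x (v - β • a - η • b)
      + (β / 2 * ‖a‖ ^ 2 + η / 2 * ‖b‖ ^ 2)) := by
    refine ⟨hu.1, fun x _ z _ r s _ _ hrs => le_of_eq ?_⟩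
    simp only [inner_add_left, real_inner_smul_left, smul_eq_mul]
    linear_combination (- (β / 2 * ‖a‖ ^ 2 + η / 2 * ‖b‖ ^ 2)) * hrs
  refine (hu.add haff).congr fun x _ => ?_
  simp only [Pi.add_apply, norm_sub_sq_real, inner_sub_right, inner_smul_right]
  ring

/-- Convexity of the function to which Jensen's inequality is applied. -/
theorem convexOn_inner_add_sq {D : Set E} {u : E → ℝ} (hu : ConvexOn ℝ D u) (v a b : E)
    {k l : ℝ} (hk : 0 ≤ k) (hl : 0 ≤ l) :
    ConvexOn ℝ D (fun y => inner ℝ v y + u y + k * ‖y - a‖ ^ 2 + l * ‖y - b‖ ^ 2) := by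
  have hsq : ∀ c : E, ConvexOn ℝ D (fun y => ‖y - c‖ ^ 2) := by
    intro c
    have h1 : ConvexOn ℝ Set.univ (fun y : E => ‖y - c‖) := by
      simpa [dist_eq_norm] using convexOn_univ_dist c
    exact (h1.pow (fun _ _ => norm_nonneg _) 2).subset (Set.subset_univ _) hu.1
  have hin : ConvexOn ℝ D (fun y => inner ℝ v y) :=
    ((innerSL ℝ v).toLinearMap.convexOn hu.1)
  exact ((hin.add hu).add ((hsq a).smul hk)).add ((hsq b).smul hl)

end Prox

section BregmanStep

variable {m : ℕ}

theorem bregman_three_point (P : Set (Wt m)) (ω : Wt m → ℝ) (p q r : Wt m) :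
    bregman P ω p r - bregman P ω p q - bregman P ω q r
      = fderivWithin ℝ ω P q (p - q) - fderivWithin ℝ ω P r (p - q) := by
  have : p - r = (p - q) + (q - r) := by abel
  unfold bregman
  rw [this, map_add]
  ring

/-- The three-point inequality for a Bregman proximal step. -/
theorem bregman_prox_three_point {P D : Set (Wt m)} {ω : Wt m → ℝ} (hP : Convex ℝ P)
    (hDP : D ⊆ P) (hω : DifferentiableOn ℝ ω P) {r : Wt m → ℝ} (hr : ConvexOn ℝ D r)
    (l : Wt m →ₗ[ℝ] ℝ) {γ : ℝ} {p₀ q : Wt m} (hq : q ∈ D)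
    (hmin : ∀ p ∈ D, l q + γ * bregman P ω q p₀ + r q ≤ l p + γ * bregman P ω p p₀ + r p)
    {p : Wt m} (hp : p ∈ D) :
    l q + r q + γ * bregman P ω q p₀ + γ * bregman P ω p q ≤ l p + r p + γ * bregman P ω p p₀ := by
  set A := fderivWithin ℝ ω P q
  set A₀ := fderivWithin ℝ ω P p₀
  have hline : HasDerivWithinAt (fun t : ℝ => ω (q + t • (p - q))) (A (p - q)) (Set.Icc 0 1) 0 := by
    have h1 : HasFDerivWithinAt ω A P (q + (0 : ℝ) • (p - q)) := by
      rw [zero_smul, add_zero]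
      exact (hω q (hDP hq)).hasFDerivWithinAt
    have h2 : HasDerivWithinAt (fun t : ℝ => q + t • (p - q)) (p - q) (Set.Icc 0 1) 0 := by
      have := ((hasDerivAt_id (0 : ℝ)).smul_const (p - q)).const_add q
      rw [one_smul] at this
      exact this.hasDerivWithinAt
    refine h1.comp_hasDerivWithinAt (0 : ℝ) h2 fun t ht => ?_
    exact hP.add_smul_sub_mem (hDP hq) (hDP hp) ht
  have hslope := hasDerivWithinAt_iff_tendsto_slope.1 hline
  have hset : Set.Icc (0 : ℝ) 1 \ {0} = Set.Ioc 0 1 := Set.Icc_sdiff_left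
  rw [hset] at hslope
  have hlow : ∀ t ∈ Set.Ioc (0 : ℝ) 1,
      0 ≤ l p - l q + r p - r q - γ * A₀ (p - q)
        + γ * slope (fun t : ℝ => ω (q + t • (p - q))) 0 t := by
    intro t ht
    have hmem : (1 - t) • q + t • p ∈ D :=
      hr.1 hq hp (by linarith [ht.2]) ht.1.le (by ring)
    have heq : (1 - t) • q + t • p = q + t • (p - q) := by module
    have h1 := hmin _ hmem
    have h2 := hr.2 hq hp (by linarith [ht.2] : 0 ≤ 1 - t) ht.1.le (by ring)
    simp only [smul_eq_mul] at h2
    have h3 : bregman P ω (q + t • (p - q)) p₀ - bregman P ω q p₀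
        = ω (q + t • (p - q)) - ω q - t * A₀ (p - q) := by
      have : q + t • (p - q) - p₀ = (q - p₀) + t • (p - q) := by abel
      unfold bregman
      rw [this, map_add, map_smul, smul_eq_mul]
      ring
    have h4 : l (q + t • (p - q)) = l q + t * (l p - l q) := by
      rw [map_add, map_smul, map_sub, smul_eq_mul]
    have h5 : slope (fun t : ℝ => ω (q + t • (p - q))) 0 t
        = (ω (q + t • (p - q)) - ω q) / t := by
      simp [slope_def_field]
    rw [heq] at h1 h2
    rw [h5]
    have h6 : 0 ≤ t * (l p - l q + r p - r q - γ * A₀ (p - q))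
        + γ * (ω (q + t • (p - q)) - ω q) := by
      rw [h4] at h1
      linear_combination h1 + h2 + γ * h3
    have h7 := div_nonneg h6 ht.1.le
    have h8 : t ≠ 0 := ht.1.ne'
    have h9 : (t * (l p - l q + r p - r q - γ * A₀ (p - q))
        + γ * (ω (q + t • (p - q)) - ω q)) / t = l p - l q + r p - r q - γ * A₀ (p - q)
        + γ * ((ω (q + t • (p - q)) - ω q) / t) := by
      field_simp
    rwa [h9] at h7
  have hlim := (hslope.const_mul γ).const_add (l p - l q + r p - r q - γ * A₀ (p - q))
  have hne : (nhdsWithin (0 : ℝ) (Set.Ioc 0 1)).NeBot := by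
    rw [nhdsWithin_Ioc_eq_nhdsGT zero_lt_one]
    infer_instance
  have hfin := ge_of_tendsto hlim (Filter.eventually_of_mem self_mem_nhdsWithin hlow)
  have h3 := bregman_three_point P ω p q p₀
  have h4 : γ * (bregman P ω p p₀ - bregman P ω p q - bregman P ω q p₀)
      = γ * (A (p - q) - A₀ (p - q)) := by rw [h3]
  linarith

theorem bregman_nonneg {P : Set (Wt m)} {N : Seminorm ℝ (Wt m)} {ω : Wt m → ℝ}
    (h : IsDistGen P N ω) {p q : Wt m} (hp : p ∈ P) (hq : q ∈ P) : 0 ≤ bregman P ω p q :=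
  le_trans (by positivity) (h.strong p hp q hq)

theorem bregman_le_radius {P : Set (Wt m)} {N : Seminorm ℝ (Wt m)} {ω : Wt m → ℝ}
    (h : IsDistGen P N ω) {p q : Wt m} (hp : p ∈ P) (hq : q ∈ P) :
    bregman P ω p q ≤ radius P ω ^ 2 / 2 := by
  have h0 := bregman_nonneg h hp hq
  have h1 : Real.sqrt (2 * bregman P ω p q) ≤ radius P ω :=
    le_csSup h.bdd ⟨p, hp, q, hq, rfl⟩
  have h2 := (Real.sqrt_le_left ((Real.sqrt_nonneg _).trans h1)).1 h1
  linarith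

end BregmanStep

section Agg

variable {n m : ℕ} {pb : RiskProblem n m}

/-- The weighted sum `∑ pᵢ vᵢ` as a linear function of `p`. -/
def wsum (v : Fin m → Vec n) : Wt m →ₗ[ℝ] Vec n := Fintype.linearCombination ℝ v

theorem wsum_apply (v : Fin m → Vec n) (p : Wt m) : wsum v p = ∑ i, p i • v i :=
  Fintype.linearCombination_apply ℝ v p

theorem inner_wsum (v : Fin m → Vec n) (p : Wt m) (y : Vec n) :
    inner ℝ (wsum v p) y = ∑ i, p i * inner ℝ (v i) y := by
  simp [wsum_apply, sum_inner, real_inner_smul_left]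

theorem agg_differentiable (h : pb.IsSmooth) (p : Wt m) : Differentiable ℝ (pb.agg p) := by
  have : Differentiable ℝ (fun x => ∑ i, p i * pb.f i x) :=
    Differentiable.fun_sum fun i _ => (h.f_diff i).const_mul (p i)
  exact this

theorem agg_convexOn (h : pb.IsSmooth) {p : Wt m} (hp : p ∈ pb.P) :
    ConvexOn ℝ Set.univ (pb.agg p) := by
  refine ⟨convex_univ, fun x _ y _ a b ha hb hab => ?_⟩
  unfold RiskProblem.agg
  simp only [smul_eq_mul]
  rw [Finset.mul_sum, Finset.mul_sum, ← Finset.sum_add_distrib]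
  refine Finset.sum_le_sum fun i _ => ?_
  have h1 := (h.f_convex i).2 (Set.mem_univ x) (Set.mem_univ y) ha hb hab
  have h2 := mul_le_mul_of_nonneg_left h1 ((h.P_subset hp).1 i)
  simp only [smul_eq_mul] at h2
  linarith

theorem gradient_agg (h : pb.IsSmooth) (p : Wt m) (x : Vec n) :
    gradient (pb.agg p) x = wsum (fun i => gradient (pb.f i) x) p := by
  refine HasGradientAt.gradient ?_
  rw [hasGradientAt_iff_hasFDerivAt]
  have h1 : HasFDerivAt (pb.agg p) (∑ i, p i • fderiv ℝ (pb.f i) x) x := by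
    have := HasFDerivAt.fun_sum (u := Finset.univ)
      (fun i _ => ((h.f_diff i) x).hasFDerivAt.const_mul (p i))
    exact this
  refine h1.congr_fderiv ?_
  simp only [wsum_apply, map_sum, map_smul, toDual_gradient]

theorem lin_agg (h : pb.IsSmooth) (p : Wt m) (z x : Vec n) :
    lin (pb.agg p) z x = ∑ i, p i * lin (pb.f i) z x := by
  unfold lin
  rw [gradient_agg h, inner_wsum]
  simp only [mul_add, Finset.sum_add_distrib]
  rfl

theorem lin_le {E : Type*} [NormedAddCommGroup E] [InnerProductSpace ℝ E] [CompleteSpace E]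
    {g : E → ℝ} (hc : ConvexOn ℝ Set.univ g)
    (hg : Differentiable ℝ g) (z x : E) : lin g z x ≤ g x :=
  gradient_inner_add_le hc hg z x

theorem isCompact_P (h : pb.IsSmooth) : IsCompact pb.P :=
  (isCompact_stdSimplex ℝ (Fin m)).of_isClosed_subset h.P_closed h.P_subset

/-- The max-structured part of the objective is finite. -/
theorem exists_agg_sub_rho_le (h : pb.IsSmooth) (x : Vec n) :
    ∃ b : ℝ, ∀ p ∈ pb.P, ((pb.agg p x : ℝ) : EReal) - pb.rho p ≤ (b : EReal) := by
  obtain ⟨c, hc⟩ := exists_lower_bound (isCompact_P h) h.rho_pcc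
  refine ⟨∑ i, |pb.f i x| - c, fun p hp => ?_⟩
  have h1 : pb.agg p x ≤ ∑ i, |pb.f i x| := by
    refine Finset.sum_le_sum fun i _ => ?_
    have hp' := h.P_subset hp
    have hp0 : 0 ≤ p i := hp'.1 i
    have hp1 : p i ≤ 1 := by
      rw [← hp'.2]
      exact Finset.single_le_sum (fun j _ => hp'.1 j) (Finset.mem_univ i)
    calc p i * pb.f i x ≤ p i * |pb.f i x| := mul_le_mul_of_nonneg_left (le_abs_self _) hp0
      _ ≤ |pb.f i x| := mul_le_of_le_one_left (abs_nonneg _) hp1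
  rw [EReal.coe_sub]
  exact EReal.sub_le_sub (EReal.coe_le_coe_iff.2 h1) (hc p hp)

theorem rho_toReal_convexOn (h : pb.IsSmooth) :
    ConvexOn ℝ (finDom pb.P pb.rho) (fun p => (pb.rho p).toReal) :=
  convexOn_toReal h.P_convex h.rho_pcc.ne_bot h.rho_pcc.convex

theorem u_toReal_strongConvexOn (h : pb.IsSmooth) {α : ℝ} (hs : StronglyConvex α pb.u) :
    StrongConvexOn (finDom pb.X pb.u) α (fun x => (pb.u x).toReal) :=
  strongConvexOn_toReal h.X_convex h.u_pcc.ne_bot h.u_pcc.convex hs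

theorem u_toReal_convexOn (h : pb.IsSmooth) :
    ConvexOn ℝ (finDom pb.X pb.u) (fun x => (pb.u x).toReal) :=
  convexOn_toReal h.X_convex h.u_pcc.ne_bot h.u_pcc.convex

theorem obj_le_coe (h : pb.IsSmooth) {z : Vec n} (hz : z ∈ finDom pb.X pb.u) {B : ℝ}
    (hB : ∀ p ∈ finDom pb.P pb.rho, pb.agg p z - (pb.rho p).toReal + (pb.u z).toReal ≤ B) :
    pb.obj z ≤ (B : EReal) := by
  have h1 : (⨆ p ∈ pb.P, ((pb.agg p z : ℝ) : EReal) - pb.rho p)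
      ≤ ((B - (pb.u z).toReal : ℝ) : EReal) := by
    refine iSup₂_le fun p hp => ?_
    by_cases ht : pb.rho p = ⊤
    · rw [ht, EReal.sub_top]
      exact bot_le
    · have := hB p ⟨hp, ht⟩
      rw [← EReal.coe_toReal ht (h.rho_pcc.ne_bot p), ← EReal.coe_sub]
      exact EReal.coe_le_coe_iff.2 (by linarith)
  have h2 := add_le_add h1 (EReal.coe_toReal hz.2 (h.u_pcc.ne_bot z)).ge
  rw [← EReal.coe_add, sub_add_cancel] at h2
  exact h2

/-- The optimal value is finite, and it is characterized by real inequalities. -/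
theorem exists_optimal_value (h : pb.IsSmooth) {xs : Vec n} (hopt : pb.IsOptimal xs) :
    xs ∈ finDom pb.X pb.u ∧ ∃ Fs : ℝ,
      (∀ p ∈ finDom pb.P pb.rho, pb.agg p xs - (pb.rho p).toReal + (pb.u xs).toReal ≤ Fs) ∧
      ∀ z ∈ finDom pb.X pb.u, ∀ B : ℝ,
        (∀ p ∈ finDom pb.P pb.rho, pb.agg p z - (pb.rho p).toReal + (pb.u z).toReal ≤ B) →
          Fs ≤ B := by
  obtain ⟨x₀, hx₀, hx₀t⟩ := h.X_dom
  obtain ⟨b, hb⟩ := exists_agg_sub_rho_le h x₀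
  have hsup : ∀ x p, p ∈ finDom pb.P pb.rho →
      ((pb.agg p x - (pb.rho p).toReal : ℝ) : EReal)
        ≤ ⨆ p ∈ pb.P, ((pb.agg p x : ℝ) : EReal) - pb.rho p := by
    intro x p hp
    rw [EReal.coe_sub, EReal.coe_toReal hp.2 (h.rho_pcc.ne_bot p)]
    exact le_iSup₂ (f := fun p _ => ((pb.agg p x : ℝ) : EReal) - pb.rho p) p hp.1
  have htop : pb.obj xs ≠ ⊤ := by
    refine ne_top_of_le_ne_top ?_ (hopt.2 x₀ hx₀)
    refine EReal.add_ne_top ?_ hx₀t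
    exact ne_top_of_le_ne_top (EReal.coe_ne_top b) (iSup₂_le hb)
  obtain ⟨p₀, hp₀, hp₀t⟩ := h.P_dom
  have hsb : ∀ x, (⨆ p ∈ pb.P, ((pb.agg p x : ℝ) : EReal) - pb.rho p) ≠ ⊥ := fun x =>
    ne_bot_of_le_ne_bot (EReal.coe_ne_bot _) (hsup x p₀ ⟨hp₀, hp₀t⟩)
  have hut : pb.u xs ≠ ⊤ := by
    intro hu
    refine htop ?_
    unfold RiskProblem.obj
    rw [hu, EReal.add_top_of_ne_bot (hsb xs)]
  have hbot : pb.obj xs ≠ ⊥ := by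
    unfold RiskProblem.obj
    rw [Ne, EReal.add_eq_bot_iff, not_or]
    exact ⟨hsb xs, h.u_pcc.ne_bot xs⟩
  refine ⟨⟨hopt.1, hut⟩, (pb.obj xs).toReal, fun p hp => ?_, fun z hz B hB => ?_⟩
  · have h1 := add_le_add (hsup xs p hp) (EReal.coe_toReal hut (h.u_pcc.ne_bot xs)).le
    rw [← EReal.coe_add] at h1
    have h2 := EReal.toReal_le_toReal h1 (EReal.coe_ne_bot _) htop
    rwa [EReal.toReal_coe] at h2
  · have h1 := (hopt.2 z hz.1).trans (obj_le_coe h hz hB)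
    have h2 := EReal.toReal_le_toReal h1 hbot (EReal.coe_ne_top _)
    rwa [EReal.toReal_coe] at h2

/-- An optimal solution also minimizes the objective in which the cost functions are replaced by
their linearizations at that solution. -/
theorem exists_optimal_value_lin (h : pb.IsSmooth) {L : ℝ} (hL : pb.AggSmooth L)
    {xs : Vec n} (hopt : pb.IsOptimal xs) :
    xs ∈ finDom pb.X pb.u ∧ ∃ Fs : ℝ,
      (∀ p ∈ finDom pb.P pb.rho, pb.agg p xs - (pb.rho p).toReal + (pb.u xs).toReal ≤ Fs) ∧
      ∀ z ∈ finDom pb.X pb.u, ∀ B : ℝ,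
        (∀ p ∈ finDom pb.P pb.rho,
          lin (pb.agg p) xs z - (pb.rho p).toReal + (pb.u z).toReal ≤ B) → Fs ≤ B := by
  obtain ⟨hxs, Fs, h1, h2⟩ := exists_optimal_value h hopt
  refine ⟨hxs, Fs, h1, fun z hz B hB => ?_⟩
  have key : ∀ r : ℝ, 0 < r → r < 1 →
      Fs ≤ B + r * (L / 2 * ‖z - xs‖ ^ 2) := by
    intro r hr0 hr1
    have hmem := (u_toReal_convexOn h).1 hxs hz (by linarith : 0 ≤ 1 - r) hr0.le (by ring)
    have hu := (u_toReal_convexOn h).2 hxs hz (by linarith : 0 ≤ 1 - r) hr0.le (by ring)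
    simp only [smul_eq_mul] at hu
    have h3 := h2 _ hmem ((1 - r) * Fs + r * B + r ^ 2 * (L / 2 * ‖z - xs‖ ^ 2)) ?_
    · have h4 : r * Fs ≤ r * (B + r * (L / 2 * ‖z - xs‖ ^ 2)) := by linarith
      exact le_of_mul_le_mul_left h4 hr0
    · intro p hp
      have hq := le_quadratic_of_lipschitz_gradient (agg_differentiable h p) (hL p hp.1) xs
        ((1 - r) • xs + r • z)
      have hd : (1 - r) • xs + r • z - xs = r • (z - xs) := by module
      rw [hd, inner_smul_right, norm_smul, Real.norm_of_nonneg hr0.le] at hq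
      have h4 := mul_le_mul_of_nonneg_left (hB p hp) hr0.le
      have h5 := mul_le_mul_of_nonneg_left (h1 p hp) (by linarith : 0 ≤ 1 - r)
      unfold lin at h4
      linarith
  have := le_of_forall_add_mul_le (A := Fs - L / 2 * ‖z - xs‖ ^ 2) (B := B)
    (c := L / 2 * ‖z - xs‖ ^ 2) fun r hr0 hr1 => by linarith [key r hr0 hr1]
  linarith

end Agg

section Inner

variable {n m : ℕ}

/-- The bilinear part `∑ pᵢ (⟨vᵢ, y⟩ - cᵢ) - r(p) + u(y)` of the Lagrangian. -/
def lagr (v : Fin m → Vec n) (c : Wt m →ₗ[ℝ] ℝ) (r : Wt m → ℝ) (u : Vec n → ℝ)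
    (y : Vec n) (p : Wt m) : ℝ := inner ℝ (wsum v p) y - c p - r p + u y

/-- Summed estimate for the inner primal-dual loop, before the last cross term is bounded. -/
theorem inner_partial {v : Fin m → Vec n} {c : Wt m →ₗ[ℝ] ℝ} {r : Wt m → ℝ} {u : Vec n → ℝ}
    {N : Seminorm ℝ (Wt m)} {U : Wt m → Wt m → ℝ} {α η G M : ℝ} {γ : ℕ → ℝ} {S : ℕ}
    {y vt : ℕ → Vec n} {p : ℕ → Wt m} {xc xs : Vec n} {ph : Wt m}
    (hα : 0 < α) (hG : 0 < G)
    (hM : ∀ q z, |inner ℝ (wsum v q) z| ≤ M * N q * ‖z‖) (hMG : M ^ 2 ≤ α * G / 4)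
    (hγ : ∀ s, s < S → ((s : ℝ) + 1) * γ (s + 1) = G)
    (hvt : ∀ s, s < S → vt (s + 1)
      = wsum v (p s) + ((s : ℝ) / (s + 1)) • wsum v (p s - p (s - 1)))
    (hy : ∀ s, s < S → inner ℝ (y (s + 1)) (vt (s + 1))
        + (α * s / 4) / 2 * ‖y (s + 1) - y s‖ ^ 2 + η / 2 * ‖y (s + 1) - xc‖ ^ 2 + u (y (s + 1))
        + (α + α * s / 4 + η) / 2 * ‖y (s + 1) - xs‖ ^ 2
      ≤ inner ℝ xs (vt (s + 1)) + (α * s / 4) / 2 * ‖xs - y s‖ ^ 2 + η / 2 * ‖xs - xc‖ ^ 2 + u xs)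
    (hp : ∀ s, s < S → -(inner ℝ (wsum v (p (s + 1))) (y (s + 1)) - c (p (s + 1))) + r (p (s + 1))
        + γ (s + 1) * U (p (s + 1)) (p s) + γ (s + 1) * U ph (p (s + 1))
      ≤ -(inner ℝ (wsum v ph) (y (s + 1)) - c ph) + r ph + γ (s + 1) * U ph (p s))
    (hU : ∀ s, s < S → N (p (s + 1) - p s) ^ 2 / 2 ≤ U (p (s + 1)) (p s)) {k : ℕ} (hk : k ≤ S) :
    ∑ s ∈ Finset.range k, ((s : ℝ) + 1) * (lagr v c r u (y (s + 1)) ph - lagr v c r u xs (p (s + 1))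
        + η / 2 * ‖y (s + 1) - xc‖ ^ 2 + (η + α / 2) / 2 * ‖y (s + 1) - xs‖ ^ 2
        - η / 2 * ‖xs - xc‖ ^ 2)
      ≤ G * U ph (p 0) - G * U ph (p k) - α * k * (k + 1) / 8 * ‖y k - xs‖ ^ 2
        - G / 2 * N (p k - p (k - 1)) ^ 2
        + k * inner ℝ (wsum v (p k - p (k - 1))) (y k - xs) := by
  induction k with
  | zero => simp
  | succ s ih =>
    have hs : s < S := hk
    have ih' := ih hs.le
    rw [Finset.sum_range_succ, Nat.add_sub_cancel]
    have hs0 : (0 : ℝ) < (s : ℝ) + 1 := by positivity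
    have hsn : (0 : ℝ) ≤ (s : ℝ) := by positivity
    have h1 := mul_le_mul_of_nonneg_left (hy s hs) hs0.le
    have h2 := mul_le_mul_of_nonneg_left (hp s hs) hs0.le
    have h3 := mul_le_mul_of_nonneg_left (hU s hs) hG.le
    -- the cross term of the extrapolation
    have hcross : (s : ℝ) * inner ℝ (wsum v (p s - p (s - 1))) (y s - y (s + 1))
        ≤ G / 2 * N (p s - p (s - 1)) ^ 2
          + (s + 1) * (α * s / 4) / 2 * ‖y (s + 1) - y s‖ ^ 2 := by
      have h4 := (le_abs_self _).trans (hM (p s - p (s - 1)) (y s - y (s + 1)))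
      rw [norm_sub_rev] at h4
      set a := N (p s - p (s - 1))
      set b := ‖y (s + 1) - y s‖
      have h5 := mul_le_mul_of_nonneg_left h4 hsn
      have h6 : (s : ℝ) * (M * a * b) ≤ G / 2 * a ^ 2 + (s * M * b) ^ 2 / (2 * G) := by
        have : G / 2 * a ^ 2 + (s * M * b) ^ 2 / (2 * G) - s * (M * a * b)
            = (G * a - s * M * b) ^ 2 / (2 * G) := by
          field_simp
          ring
        have h7 : 0 ≤ (G * a - s * M * b) ^ 2 / (2 * G) := by positivity
        linarith
      have h7 : (s * M * b) ^ 2 / (2 * G) ≤ (s + 1) * (α * s / 4) / 2 * b ^ 2 := by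
        rw [div_le_iff₀ (by positivity)]
        have h8 := mul_le_mul_of_nonneg_left hMG (by positivity : 0 ≤ (s : ℝ) ^ 2 * b ^ 2)
        have h9 : 0 ≤ (s : ℝ) * α * G * b ^ 2 := by positivity
        nlinarith
      linarith
    have hlin : ((s : ℝ) + 1) * (inner ℝ (y (s + 1)) (vt (s + 1)) - inner ℝ xs (vt (s + 1)))
        = (s + 1) * inner ℝ (wsum v (p (s + 1))) (y (s + 1) - xs)
          - (s + 1) * inner ℝ (wsum v (p (s + 1) - p s)) (y (s + 1) - xs)
          + s * inner ℝ (wsum v (p s - p (s - 1))) (y s - xs)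
          - s * inner ℝ (wsum v (p s - p (s - 1))) (y s - y (s + 1)) := by
      rw [hvt s hs, ← inner_sub_left, inner_add_right, inner_smul_right,
        real_inner_comm (wsum v (p s)), real_inner_comm (wsum v (p s - p (s - 1))), map_sub, map_sub]
      simp only [inner_sub_left, inner_sub_right]
      field_simp
      ring
    have hnr : ‖xs - y s‖ = ‖y s - xs‖ := norm_sub_rev _ _
    rw [hnr] at h1
    have hγs := hγ s hs
    have e1 : ∀ z : ℝ, ((s : ℝ) + 1) * (γ (s + 1) * z) = G * z := fun z => by
      rw [← mul_assoc, hγs]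
    have h2' : ((s : ℝ) + 1) * (-(inner ℝ (wsum v (p (s + 1))) (y (s + 1)) - c (p (s + 1)))
        + r (p (s + 1))) + G * U (p (s + 1)) (p s) + G * U ph (p (s + 1))
        ≤ (s + 1) * (-(inner ℝ (wsum v ph) (y (s + 1)) - c ph) + r ph) + G * U ph (p s) := by
      rw [← e1, ← e1, ← e1]
      linarith
    rw [inner_sub_right (wsum v (p (s + 1)))] at hlin
    push_cast
    unfold lagr at ih' ⊢
    linarith

/-- Summed estimate for the inner primal-dual loop. -/
theorem inner_sum_le {v : Fin m → Vec n} {c : Wt m →ₗ[ℝ] ℝ} {r : Wt m → ℝ} {u : Vec n → ℝ}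
    {N : Seminorm ℝ (Wt m)} {U : Wt m → Wt m → ℝ} {α η G M : ℝ} {γ : ℕ → ℝ} {S : ℕ}
    {y vt : ℕ → Vec n} {p : ℕ → Wt m} {xc xs : Vec n} {ph : Wt m}
    (hα : 0 < α) (hG : 0 < G)
    (hM : ∀ q z, |inner ℝ (wsum v q) z| ≤ M * N q * ‖z‖) (hMG : M ^ 2 ≤ α * G / 4)
    (hγ : ∀ s, s < S → ((s : ℝ) + 1) * γ (s + 1) = G)
    (hvt : ∀ s, s < S → vt (s + 1)
      = wsum v (p s) + ((s : ℝ) / (s + 1)) • wsum v (p s - p (s - 1)))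
    (hy : ∀ s, s < S → inner ℝ (y (s + 1)) (vt (s + 1))
        + (α * s / 4) / 2 * ‖y (s + 1) - y s‖ ^ 2 + η / 2 * ‖y (s + 1) - xc‖ ^ 2 + u (y (s + 1))
        + (α + α * s / 4 + η) / 2 * ‖y (s + 1) - xs‖ ^ 2
      ≤ inner ℝ xs (vt (s + 1)) + (α * s / 4) / 2 * ‖xs - y s‖ ^ 2 + η / 2 * ‖xs - xc‖ ^ 2 + u xs)
    (hp : ∀ s, s < S → -(inner ℝ (wsum v (p (s + 1))) (y (s + 1)) - c (p (s + 1))) + r (p (s + 1))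
        + γ (s + 1) * U (p (s + 1)) (p s) + γ (s + 1) * U ph (p (s + 1))
      ≤ -(inner ℝ (wsum v ph) (y (s + 1)) - c ph) + r ph + γ (s + 1) * U ph (p s))
    (hU : ∀ s, s < S → N (p (s + 1) - p s) ^ 2 / 2 ≤ U (p (s + 1)) (p s)) :
    ∑ s ∈ Finset.range S, ((s : ℝ) + 1) * (lagr v c r u (y (s + 1)) ph - lagr v c r u xs (p (s + 1))
        + η / 2 * ‖y (s + 1) - xc‖ ^ 2 + (η + α / 2) / 2 * ‖y (s + 1) - xs‖ ^ 2
        - η / 2 * ‖xs - xc‖ ^ 2)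
      ≤ G * U ph (p 0) - G * U ph (p S) := by
  have h1 := inner_partial hα hG hM hMG hγ hvt hy hp hU le_rfl
  have h4 := (le_abs_self _).trans (hM (p S - p (S - 1)) (y S - xs))
  have hsn : (0 : ℝ) ≤ (S : ℝ) := by positivity
  set a := N (p S - p (S - 1))
  set b := ‖y S - xs‖
  have h5 := mul_le_mul_of_nonneg_left h4 hsn
  have h6 : (S : ℝ) * (M * a * b) ≤ G / 2 * a ^ 2 + (S * M * b) ^ 2 / (2 * G) := by
    have : G / 2 * a ^ 2 + (S * M * b) ^ 2 / (2 * G) - S * (M * a * b)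
        = (G * a - S * M * b) ^ 2 / (2 * G) := by
      field_simp
      ring
    have h7 : 0 ≤ (G * a - S * M * b) ^ 2 / (2 * G) := by positivity
    linarith
  have h7 : (S * M * b) ^ 2 / (2 * G) ≤ α * S * (S + 1) / 8 * b ^ 2 := by
    rw [div_le_iff₀ (by positivity)]
    have h8 := mul_le_mul_of_nonneg_left hMG (by positivity : 0 ≤ (S : ℝ) ^ 2 * b ^ 2)
    have h9 : 0 ≤ (S : ℝ) * α * G * b ^ 2 := by positivity
    nlinarith
  linarith

end Inner

section OpNorm

variable {n m : ℕ}

/-- A norm on `ℝᵐ` dominates the maximum norm up to a factor. -/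
theorem exists_norm_le_mul {N : Seminorm ℝ (Wt m)} (hN : ∀ p, N p = 0 → p = 0) :
    ∃ k : ℝ, 0 ≤ k ∧ ∀ p : Wt m, ‖p‖ ≤ k * N p := by
  have hcont : Continuous N := by
    let C : NNReal := ⟨∑ i : Fin m, N (Pi.single i 1),
      Finset.sum_nonneg fun i _ => apply_nonneg N _⟩
    have hle : N ≤ C • normSeminorm ℝ (Wt m) := by
      intro p
      have hp : p = ∑ i, p i • (Pi.single i (1 : ℝ) : Wt m) := by
        ext j
        simp [Finset.sum_apply, Pi.single_apply]
      calc N p = N (∑ i, p i • (Pi.single i (1 : ℝ) : Wt m)) := by rw [← hp]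
        _ ≤ ∑ i, N (p i • (Pi.single i (1 : ℝ) : Wt m)) :=
            Finset.le_sum_of_subadditive N (map_zero N).le (map_add_le_add N) _ _
        _ ≤ ∑ i, N (Pi.single i (1 : ℝ)) * ‖p‖ := by
            refine Finset.sum_le_sum fun i _ => ?_
            rw [map_smul_eq_mul, mul_comm]
            exact mul_le_mul_of_nonneg_left (norm_le_pi_norm p i) (apply_nonneg N _)
        _ = (∑ i, N (Pi.single i (1 : ℝ))) * ‖p‖ := by rw [← Finset.sum_mul]
    refine Seminorm.continuous_of_le ?_ hle
    exact continuous_const.mul continuous_norm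
  rcases subsingleton_or_nontrivial (Wt m) with hs | hs
  · exact ⟨0, le_rfl, fun p => by simp [Subsingleton.elim p 0]⟩
  · obtain ⟨q, hq, hmin⟩ := (isCompact_sphere (0 : Wt m) 1).exists_isMinOn
      (NormedSpace.sphere_nonempty.2 zero_le_one) hcont.continuousOn
    have hq0 : q ≠ 0 := by
      rintro rfl
      simp at hq
    have hNq : 0 < N q := lt_of_le_of_ne (apply_nonneg N q) fun h => hq0 (hN q h.symm)
    refine ⟨(N q)⁻¹, by positivity, fun p => ?_⟩
    by_cases hp : p = 0
    · simp [hp]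
    · have hpn : 0 < ‖p‖ := norm_pos_iff.2 hp
      have hmem : ‖p‖⁻¹ • p ∈ Metric.sphere (0 : Wt m) 1 := by
        simp [norm_smul, hpn.ne']
      have h1 : N q ≤ N (‖p‖⁻¹ • p) := hmin hmem
      rw [map_smul_eq_mul, norm_inv, norm_norm, ← div_eq_inv_mul, le_div_iff₀ hpn] at h1
      rw [← div_eq_inv_mul, le_div_iff₀ hNq]
      linarith

theorem sum_mul_inner_le {N : Seminorm ℝ (Wt m)} {k : ℝ} (hk0 : 0 ≤ k)
    (hk : ∀ p : Wt m, ‖p‖ ≤ k * N p) {v : Fin m → Vec n} {V : ℝ} (hV : ∀ i, ‖v i‖ ≤ V)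
    {p : Wt m} (hp : N p ≤ 1) {y : Vec n} (hy : ‖y‖ ≤ 1) :
    ∑ i, p i * inner ℝ (v i) y ≤ m * (k * V) := by
  have : ∀ i ∈ Finset.univ, p i * inner ℝ (v i) y ≤ k * V := by
    intro i _
    have hpk : ‖p‖ ≤ k := (hk p).trans (mul_le_of_le_one_right hk0 hp)
    calc p i * inner ℝ (v i) y ≤ ‖p i‖ * (‖v i‖ * ‖y‖) := by
          refine (le_abs_self _).trans ?_
          rw [abs_mul]
          exact mul_le_mul_of_nonneg_left (abs_real_inner_le_norm _ _) (abs_nonneg _)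
      _ ≤ k * (V * 1) := by
          have hV0 := (norm_nonneg _).trans (hV i)
          gcongr
          · exact (norm_le_pi_norm p i).trans hpk
          · exact hV i
      _ = k * V := by ring
  calc _ ≤ ∑ _i : Fin m, k * V := Finset.sum_le_sum this
    _ = _ := by simp

theorem opNorm_le {N : Seminorm ℝ (Wt m)} {k : ℝ} (hk0 : 0 ≤ k)
    (hk : ∀ p : Wt m, ‖p‖ ≤ k * N p) {v : Fin m → Vec n} {V : ℝ} (hV : ∀ i, ‖v i‖ ≤ V) :
    opNorm N v ≤ m * (k * V) := by
  refine csSup_le ⟨0, 0, by simp, 0, by simp, by simp⟩ ?_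
  rintro _ ⟨p, hp, y, hy, rfl⟩
  exact sum_mul_inner_le hk0 hk hV hp hy

theorem bddAbove_opNorm {N : Seminorm ℝ (Wt m)} (hN : ∀ p, N p = 0 → p = 0)
    (v : Fin m → Vec n) :
    BddAbove {r | ∃ p : Wt m, N p ≤ 1 ∧ ∃ y : Vec n, ‖y‖ ≤ 1 ∧ r = ∑ i, p i * inner ℝ (v i) y} := by
  obtain ⟨k, hk0, hk⟩ := exists_norm_le_mul hN
  refine ⟨m * (k * ‖v‖), ?_⟩
  rintro _ ⟨p, hp, y, hy, rfl⟩
  exact sum_mul_inner_le hk0 hk (norm_le_pi_norm v) hp hy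

theorem opNorm_nonneg {N : Seminorm ℝ (Wt m)} (hN : ∀ p, N p = 0 → p = 0)
    (v : Fin m → Vec n) : 0 ≤ opNorm N v :=
  le_csSup (bddAbove_opNorm hN v) ⟨0, by simp, 0, by simp, by simp⟩

theorem inner_wsum_le_opNorm {N : Seminorm ℝ (Wt m)} (hN : ∀ p, N p = 0 → p = 0)
    (v : Fin m → Vec n) (q : Wt m) (z : Vec n) :
    |inner ℝ (wsum v q) z| ≤ opNorm N v * N q * ‖z‖ := by
  have key : ∀ q z, inner ℝ (wsum v q) z ≤ opNorm N v * N q * ‖z‖ := by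
    intro q z
    by_cases hq : q = 0
    · simp [hq]
    by_cases hz : z = 0
    · simp [hz]
    have hq' : 0 < N q := lt_of_le_of_ne (apply_nonneg N q) fun h => hq (hN q h.symm)
    have hz' : 0 < ‖z‖ := norm_pos_iff.2 hz
    have h1 : inner ℝ (wsum v ((N q)⁻¹ • q)) (‖z‖⁻¹ • z) ≤ opNorm N v := by
      refine le_csSup (bddAbove_opNorm hN v) ⟨(N q)⁻¹ • q, ?_, ‖z‖⁻¹ • z, ?_, inner_wsum _ _ _⟩
      · rw [map_smul_eq_mul, norm_inv, Real.norm_of_nonneg hq'.le, inv_mul_cancel₀ hq'.ne']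
      · rw [norm_smul, norm_inv, norm_norm, inv_mul_cancel₀ hz'.ne']
    rw [map_smul, real_inner_smul_left, real_inner_smul_right] at h1
    calc inner ℝ (wsum v q) z
        = (N q * ‖z‖) * ((N q)⁻¹ * (‖z‖⁻¹ * inner ℝ (wsum v q) z)) := by field_simp
      _ ≤ (N q * ‖z‖) * opNorm N v := mul_le_mul_of_nonneg_left h1 (by positivity)
      _ = _ := by ring
  refine abs_le.2 ⟨?_, key q z⟩
  have := key q (-z)
  rw [inner_neg_right, norm_neg] at this
  linarith

end OpNorm

section Averages

theorem sum_Icc_one {A : Type*} [AddCommMonoid A] (f : ℕ → A) (S : ℕ) :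
    ∑ s ∈ Finset.Icc 1 S, f s = ∑ s ∈ Finset.range S, f (s + 1) := by
  induction S with
  | zero => simp
  | succ S ih => rw [Finset.sum_Icc_succ_top (by omega), Finset.sum_range_succ, ih]

theorem jensen_sum {E : Type*} [AddCommGroup E] [Module ℝ E] {D : Set E} {Φ : E → ℝ}
    (hΦ : ConvexOn ℝ D Φ) {ι : Type*} {T : Finset ι} {w : ι → ℝ} {z : ι → E}
    (hw : ∀ i ∈ T, 0 ≤ w i) (hpos : 0 < ∑ i ∈ T, w i) (hz : ∀ i ∈ T, z i ∈ D) :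
    (∑ i ∈ T, w i) * Φ ((∑ i ∈ T, w i)⁻¹ • ∑ i ∈ T, w i • z i) ≤ ∑ i ∈ T, w i * Φ (z i) := by
  have h := hΦ.map_centerMass_le hw hpos hz
  unfold Finset.centerMass at h
  simp only [smul_eq_mul, Function.comp_apply] at h
  calc _ ≤ (∑ i ∈ T, w i) * ((∑ i ∈ T, w i)⁻¹ * ∑ i ∈ T, w i * Φ (z i)) :=
        mul_le_mul_of_nonneg_left h hpos.le
    _ = _ := by rw [← mul_assoc, mul_inv_cancel₀ hpos.ne', one_mul]

theorem sum_range_add_one_cast (S : ℕ) :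
    ∑ s ∈ Finset.range S, ((s : ℝ) + 1) = S * (S + 1) / 2 := by
  induction S with
  | zero => simp
  | succ S ih =>
    rw [Finset.sum_range_succ, ih]
    push_cast
    ring

end Averages

section Constants

variable {α L κ : ℝ}

/-- The dual stepsize of the outer loop. -/
def tauStr (κ : ℝ) : ℝ := (Real.sqrt (8 * κ + 1) - 1) / 2

theorem tauStr_pos (hκ : 0 < κ) : 0 < tauStr κ := by
  have : 1 < Real.sqrt (8 * κ + 1) := Real.lt_sqrt_of_sq_lt (by linarith)
  unfold tauStr
  linarith

theorem thetaStr_eq (hκ : 0 < κ) : thetaStr κ = tauStr κ / (1 + tauStr κ) := by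
  have : 1 < Real.sqrt (8 * κ + 1) := Real.lt_sqrt_of_sq_lt (by linarith)
  unfold thetaStr tauStr
  rw [div_eq_div_iff (by linarith) (by linarith)]
  ring

theorem etaStr_eq : etaStr α κ = α * tauStr κ / 2 := by
  unfold etaStr tauStr
  ring

theorem tauStr_mul (hκ : 0 < κ) : tauStr κ * (1 + tauStr κ) = 2 * κ := by
  have := Real.sq_sqrt (by linarith : 0 ≤ 8 * κ + 1)
  unfold tauStr
  linarith

theorem thetaStr_pos (hκ : 0 < κ) : 0 < thetaStr κ := by
  have := tauStr_pos hκ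
  rw [thetaStr_eq hκ]
  positivity

theorem thetaStr_lt_one (hκ : 0 < κ) : thetaStr κ < 1 := by
  have := tauStr_pos hκ
  rw [thetaStr_eq hκ, div_lt_one (by linarith)]
  linarith

theorem wStr_pos (hκ : 0 < κ) (t : ℕ) : 0 < wStr κ t := by
  have := thetaStr_pos hκ
  unfold wStr
  positivity

end Constants

section Phase

variable {n m : ℕ} {pb : RiskProblem n m} {α κ Δ : ℝ} {N : Seminorm ℝ (Wt m)}
  {ω : Wt m → ℝ} {st : Stepsizes} {it : Iterates n m}

theorem one_le_S {M : ℕ → ℝ} (hst : IsStrStepsizes st α κ Δ M) {t : ℕ} (ht : 1 ≤ t) :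
    1 ≤ st.S t := by
  rw [hst.S_eq t ht]
  exact le_max_left _ _

theorem p_zero_mem {M : ℕ → ℝ} (hst : IsStrStepsizes st α κ Δ M) (hg : it.IsGenerated pb st ω)
    {t : ℕ} (ht : 1 ≤ t) : it.p t 0 ∈ pb.P := by
  rcases Nat.exists_eq_add_of_le' ht with ⟨k, rfl⟩
  rcases Nat.eq_zero_or_pos k with rfl | hk
  · exact hg.p_init
  · rw [hg.p_next k hk]
    exact hg.p_mem k _ hk (one_le_S hst hk) le_rfl

theorem p_mem_of_le {M : ℕ → ℝ} (hst : IsStrStepsizes st α κ Δ M) (hg : it.IsGenerated pb st ω)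
    {t s : ℕ} (ht : 1 ≤ t) (hs : s ≤ st.S t) : it.p t s ∈ pb.P := by
  rcases Nat.eq_zero_or_pos s with rfl | hs0
  · exact p_zero_mem hst hg ht
  · exact hg.p_mem t s ht hs0 hs

/-- The linear functional `p ↦ ∑ pᵢ fᵢ*(πᵢᵗ)`. -/
def conjSum (it : Iterates n m) (pb : RiskProblem n m) (st : Stepsizes) (t : ℕ) :
    Wt m →ₗ[ℝ] ℝ := Fintype.linearCombination ℝ (it.fconj pb st t)

theorem conjSum_apply (t : ℕ) (p : Wt m) :
    conjSum it pb st t p = ∑ i, p i * it.fconj pb st t i := by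
  simp [conjSum, Fintype.linearCombination_apply]

theorem sum_mul_inner_sub_fconj (t : ℕ) (p : Wt m) (y : Vec n) :
    ∑ i, p i * (inner ℝ (it.v pb st t i) y - it.fconj pb st t i)
      = inner ℝ (wsum (it.v pb st t) p) y - conjSum it pb st t p := by
  rw [inner_wsum, conjSum_apply, ← Finset.sum_sub_distrib]
  exact Finset.sum_congr rfl fun i _ => by ring

theorem inner_wsum_sub_conjSum (h : pb.IsSmooth) (t : ℕ) (p : Wt m) (y : Vec n) :
    inner ℝ (wsum (it.v pb st t) p) y - conjSum it pb st t p
      = lin (pb.agg p) (it.xund st t) y := by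
  rw [lin_agg h, ← sum_mul_inner_sub_fconj]
  refine Finset.sum_congr rfl fun i _ => ?_
  congr 1
  unfold lin Iterates.fconj Iterates.v
  rw [inner_sub_right]
  have := real_inner_comm (it.xund st t) (gradient (pb.f i) (it.xund st t))
  linarith

theorem y_step (h : pb.IsSmooth) (hs : StronglyConvex α pb.u) (hg : it.IsGenerated pb st ω)
    {t s : ℕ} (ht : 1 ≤ t) (hs1 : 1 ≤ s) (hsS : s ≤ st.S t) :
    it.y t s ∈ finDom pb.X pb.u ∧ ∀ x ∈ finDom pb.X pb.u,
      inner ℝ (it.y t s) (it.vtil pb st t s) + st.beta t s / 2 * ‖it.y t s - it.y t (s - 1)‖ ^ 2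
          + st.eta t / 2 * ‖it.y t s - it.x (t - 1)‖ ^ 2 + (pb.u (it.y t s)).toReal
          + (α + st.beta t s + st.eta t) / 2 * ‖it.y t s - x‖ ^ 2
        ≤ inner ℝ x (it.vtil pb st t s) + st.beta t s / 2 * ‖x - it.y t (s - 1)‖ ^ 2
          + st.eta t / 2 * ‖x - it.x (t - 1)‖ ^ 2 + (pb.u x).toReal := by
  obtain ⟨hy, hmin⟩ := toReal_min (φ := fun y => inner ℝ y (it.vtil pb st t s)
      + st.beta t s / 2 * ‖y - it.y t (s - 1)‖ ^ 2 + st.eta t / 2 * ‖y - it.x (t - 1)‖ ^ 2)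
    h.u_pcc.ne_bot h.X_dom (hg.y_mem t s ht hs1 hsS)
    (hg.y_min t s ht hs1 hsS)
  exact ⟨hy, fun x hx => prox_three_point (u_toReal_strongConvexOn h hs) hy hmin hx⟩

theorem p_step (h : pb.IsSmooth) (hω : IsDistGen pb.P N ω) (hg : it.IsGenerated pb st ω)
    {t s : ℕ} (ht : 1 ≤ t) (hs1 : 1 ≤ s) (hsS : s ≤ st.S t) :
    it.p t s ∈ finDom pb.P pb.rho ∧ ∀ p ∈ finDom pb.P pb.rho,
      -(inner ℝ (wsum (it.v pb st t) (it.p t s)) (it.y t s) - conjSum it pb st t (it.p t s))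
          + (pb.rho (it.p t s)).toReal
          + st.gamma t s * bregman pb.P ω (it.p t s) (it.p t (s - 1))
          + st.gamma t s * bregman pb.P ω p (it.p t s)
        ≤ -(inner ℝ (wsum (it.v pb st t) p) (it.y t s) - conjSum it pb st t p)
          + (pb.rho p).toReal + st.gamma t s * bregman pb.P ω p (it.p t (s - 1)) := by
  have hm := hg.p_min t s ht hs1 hsS
  unfold Iterates.pObj at hm
  simp only [sum_mul_inner_sub_fconj] at hm
  obtain ⟨hp, hmin⟩ := toReal_min (φ := fun p =>
    -(inner ℝ (wsum (it.v pb st t) p) (it.y t s) - conjSum it pb st t p)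
      + st.gamma t s * bregman pb.P ω p (it.p t (s - 1)))
    h.rho_pcc.ne_bot h.P_dom (hg.p_mem t s ht hs1 hsS) hm
  refine ⟨hp, fun p hp' => ?_⟩
  let l : Wt m →ₗ[ℝ] ℝ := -((innerSL ℝ (it.y t s)).toLinearMap ∘ₗ wsum (it.v pb st t)
    - conjSum it pb st t)
  have hl : ∀ p, l p
      = -(inner ℝ (wsum (it.v pb st t) p) (it.y t s) - conjSum it pb st t p) := by
    intro p
    rw [real_inner_comm]
    rfl
  have := bregman_prox_three_point h.P_convex (fun p hp => hp.1) hω.diff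
    (rho_toReal_convexOn h) l (γ := st.gamma t s) (p₀ := it.p t (s - 1)) hp
    (by simpa only [hl] using hmin) hp'
  simpa only [hl] using this

theorem vtil_succ {M : ℕ → ℝ} (hst : IsStrStepsizes st α κ Δ M) {t : ℕ} (ht : 1 ≤ t) (s : ℕ) :
    it.vtil pb st t (s + 1) = wsum (it.v pb st t) (it.p t s)
      + ((s : ℝ) / (s + 1)) • wsum (it.v pb st t) (it.p t s - it.p t (s - 1)) := by
  have hd := hst.delta_eq t (s + 1) ht (by omega)
  unfold Iterates.vtil
  rcases Nat.eq_zero_or_pos s with rfl | hs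
  · rw [Nat.zero_add] at hd
    simp [hd, wsum_apply]
  · rw [if_neg (by omega), hd, wsum_apply, wsum_apply]
    have : s + 1 - 2 = s - 1 := by omega
    simp only [Nat.add_sub_cancel, this, Pi.sub_apply]
    push_cast
    rw [add_sub_cancel_right]

theorem x_eq {M : ℕ → ℝ} (hst : IsStrStepsizes st α κ Δ M) (hg : it.IsGenerated pb st ω)
    {t : ℕ} (ht : 1 ≤ t) : it.x t = (∑ s ∈ Finset.range (st.S t), ((s : ℝ) + 1))⁻¹ •
      ∑ s ∈ Finset.range (st.S t), ((s : ℝ) + 1) • it.y t (s + 1) := by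
  rw [hg.x_next t ht, sum_Icc_one, sum_Icc_one]
  have : ∀ s, st.q t (s + 1) = (s : ℝ) + 1 := fun s => by
    rw [hst.q_eq t (s + 1) ht (by omega)]
    push_cast
    rfl
  simp only [this]

theorem sum_weights_pos {M : ℕ → ℝ} (hst : IsStrStepsizes st α κ Δ M) {t : ℕ} (ht : 1 ≤ t) :
    0 < ∑ s ∈ Finset.range (st.S t), ((s : ℝ) + 1) := by
  rw [sum_range_add_one_cast]
  have : (1 : ℝ) ≤ st.S t := by exact_mod_cast one_le_S hst ht
  positivity

theorem x_mem (h : pb.IsSmooth) (hs : StronglyConvex α pb.u) {M : ℕ → ℝ}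
    (hst : IsStrStepsizes st α κ Δ M) (hg : it.IsGenerated pb st ω) {t : ℕ} (ht : 1 ≤ t) :
    it.x t ∈ finDom pb.X pb.u := by
  rw [x_eq hst hg ht]
  refine (u_toReal_convexOn h).1.centerMass_mem (fun s _ => by positivity)
    (sum_weights_pos hst ht) fun s hs' => ?_
  exact (y_step h hs hg ht (by omega) (Finset.mem_range.1 hs')).1

/-- The progress of one phase of the method. -/
theorem phase_le (h : pb.IsSmooth) (hα : 0 < α) (hs : StronglyConvex α pb.u)
    (hω : IsDistGen pb.P N ω) (hκ : 0 < κ) (hΔ : 0 < Δ)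
    (hst : IsStrStepsizes st α κ Δ (it.M pb st N)) (hg : it.IsGenerated pb st ω)
    {xs : Vec n} (hxs : xs ∈ finDom pb.X pb.u) {Fs : ℝ}
    (hFs : ∀ p ∈ finDom pb.P pb.rho, pb.agg p xs - (pb.rho p).toReal + (pb.u xs).toReal ≤ Fs)
    {t : ℕ} (ht : 1 ≤ t) {ph : Wt m} (hph : ph ∈ finDom pb.P pb.rho) :
    wStr κ t * (lin (pb.agg ph) (it.xund st t) (it.x t) - (pb.rho ph).toReal
        + (pb.u (it.x t)).toReal - Fs + etaStr α κ / 2 * ‖it.x t - it.x (t - 1)‖ ^ 2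
        + (etaStr α κ + α / 2) / 2 * ‖it.x t - xs‖ ^ 2
        - etaStr α κ / 2 * ‖xs - it.x (t - 1)‖ ^ 2)
      ≤ 4 / (α * Δ) * (bregman pb.P ω ph (it.p t 0) - bregman pb.P ω ph (it.p t (st.S t))) := by
  set S := st.S t with hSdef
  set w := wStr κ t with hw
  set η := etaStr α κ with hη
  have hwpos : 0 < w := wStr_pos hκ t
  have hS1 : (1 : ℝ) ≤ S := by exact_mod_cast one_le_S hst ht
  set v := it.v pb st t with hv
  set G := 2 * (S : ℝ) * (S + 1) / (w * α * Δ) with hG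
  have hGpos : 0 < G := by positivity
  have hη0 : 0 < η := by
    rw [hη, etaStr_eq]
    have := tauStr_pos hκ
    positivity
  have hMG : opNorm N v ^ 2 ≤ α * G / 4 := by
    have hM0 : 0 ≤ opNorm N v := opNorm_nonneg hω.norm_def v
    have h1 : Real.sqrt (2 * w * Δ) * opNorm N v ≤ S := by
      have h2 := hst.S_eq t ht
      have h3 : ⌈Real.sqrt (2 * w * Δ) * opNorm N v⌉₊ ≤ S := by
        rw [hSdef, h2]
        exact le_max_right _ _
      exact (Nat.le_ceil _).trans (by exact_mod_cast h3)
    have h2 : 2 * w * Δ * opNorm N v ^ 2 ≤ (S : ℝ) ^ 2 := by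
      have := pow_le_pow_left₀ (by positivity) h1 2
      rwa [mul_pow, Real.sq_sqrt (by positivity)] at this
    have h3 : α * G / 4 = S * (S + 1) / (2 * w * Δ) := by
      rw [hG]
      field_simp
      norm_num
    rw [h3, le_div_iff₀ (by positivity)]
    nlinarith
  have hinner := inner_sum_le (v := v) (c := conjSum it pb st t) (r := fun p => (pb.rho p).toReal)
    (u := fun x => (pb.u x).toReal) (U := bregman pb.P ω) (η := η) (γ := st.gamma t) (S := S)
    (y := it.y t) (vt := it.vtil pb st t) (p := it.p t) (xc := it.x (t - 1)) (xs := xs)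
    (ph := ph) hα hGpos (inner_wsum_le_opNorm hω.norm_def v) hMG
    (fun s _ => by
      rw [hst.gamma_eq t (s + 1) ht (by omega), ← hSdef, ← hw, hG]
      push_cast
      field_simp)
    (fun s _ => vtil_succ hst ht s)
    (fun s hsS => by
      have h1 := (y_step h hs hg ht (by omega : 1 ≤ s + 1) hsS).2 xs hxs
      rw [hst.beta_eq t (s + 1) ht (by omega), hst.eta_eq t ht, Nat.add_sub_cancel] at h1
      push_cast at h1
      rwa [add_sub_cancel_right] at h1)
    (fun s hsS => (p_step h hω hg ht (by omega : 1 ≤ s + 1) hsS).2 ph hph)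
    (fun s hsS => hω.strong _ (p_mem_of_le hst hg ht hsS) _ (p_mem_of_le hst hg ht hsS.le))
  set Φ : Vec n → ℝ := fun y => inner ℝ (wsum v ph) y + (pb.u y).toReal
    + η / 2 * ‖y - it.x (t - 1)‖ ^ 2 + (η + α / 2) / 2 * ‖y - xs‖ ^ 2 with hΦ
  have hΦc : ConvexOn ℝ (finDom pb.X pb.u) Φ :=
    convexOn_inner_add_sq (u_toReal_convexOn h) _ _ _ (by positivity) (by positivity)
  have hJ := jensen_sum hΦc (T := Finset.range S) (w := fun s => (s : ℝ) + 1)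
    (z := fun s => it.y t (s + 1)) (fun s _ => by positivity) (sum_weights_pos hst ht)
    (fun s hs' => (y_step h hs hg ht (by omega) (Finset.mem_range.1 hs')).1)
  rw [← x_eq hst hg ht] at hJ
  set Q := ∑ s ∈ Finset.range S, ((s : ℝ) + 1) with hQ
  have hQe : Q = S * (S + 1) / 2 := sum_range_add_one_cast S
  have hQpos : 0 < Q := sum_weights_pos hst ht
  set C := conjSum it pb st t ph + (pb.rho ph).toReal + Fs
    + η / 2 * ‖xs - it.x (t - 1)‖ ^ 2 with hC
  have hsum : ∑ s ∈ Finset.range S, ((s : ℝ) + 1) * Φ (it.y t (s + 1)) - Q * C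
      ≤ G * bregman pb.P ω ph (it.p t 0) - G * bregman pb.P ω ph (it.p t S) := by
    refine le_trans ?_ hinner
    rw [hQ, Finset.sum_mul, ← Finset.sum_sub_distrib]
    refine Finset.sum_le_sum fun s hs' => ?_
    rw [← mul_sub]
    refine mul_le_mul_of_nonneg_left ?_ (by positivity)
    have hpD := (p_step h hω hg ht (by omega : 1 ≤ s + 1) (Finset.mem_range.1 hs')).1
    have h1 := hFs _ hpD
    have h2 : lin (pb.agg (it.p t (s + 1))) (it.xund st t) xs ≤ pb.agg (it.p t (s + 1)) xs :=
      lin_le (agg_convexOn h hpD.1) (agg_differentiable h _) _ _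
    have h3 : inner ℝ (wsum v (it.p t (s + 1))) xs - conjSum it pb st t (it.p t (s + 1))
      = lin (pb.agg (it.p t (s + 1))) (it.xund st t) xs := inner_wsum_sub_conjSum h t _ xs
    simp only [hΦ, hC, lagr]
    linarith
  have hlin : inner ℝ (wsum v ph) (it.x t) - conjSum it pb st t ph
      = lin (pb.agg ph) (it.xund st t) (it.x t) := inner_wsum_sub_conjSum h t ph (it.x t)
  have hfin : Q * (lin (pb.agg ph) (it.xund st t) (it.x t) - (pb.rho ph).toReal
        + (pb.u (it.x t)).toReal - Fs + η / 2 * ‖it.x t - it.x (t - 1)‖ ^ 2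
        + (η + α / 2) / 2 * ‖it.x t - xs‖ ^ 2
        - η / 2 * ‖xs - it.x (t - 1)‖ ^ 2)
      ≤ G * (bregman pb.P ω ph (it.p t 0) - bregman pb.P ω ph (it.p t S)) := by
    rw [← hlin]
    simp only [hΦ] at hJ
    simp only [hC] at hsum
    simp only [hΦ] at hsum
    linarith
  have hGw : G = Q * (4 / (α * Δ) / w) := by
    rw [hG, hQe]
    field_simp
    norm_num
  rw [hGw, mul_assoc] at hfin
  have h5 := le_of_mul_le_mul_left hfin hQpos
  have h6 := mul_le_mul_of_nonneg_left h5 hwpos.le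
  refine h6.trans (le_of_eq ?_)
  field_simp

end Phase

section Main

variable {n m : ℕ} {pb : RiskProblem n m} {α L Δ : ℝ} {N : Seminorm ℝ (Wt m)}
  {ω : Wt m → ℝ} {st : Stepsizes} {it : Iterates n m}

theorem xund_succ {κ : ℝ} {M : ℕ → ℝ} (hκ : 0 < κ) (hst : IsStrStepsizes st α κ Δ M) (t : ℕ) :
    (1 + tauStr κ) • it.xund st (t + 1)
      = it.x t + thetaStr κ • (it.x t - it.x (t - 1)) + tauStr κ • it.xund st t := by
  have hτ := tauStr_pos hκ
  have h1 : st.tau (t + 1) = tauStr κ := hst.tau_eq (t + 1) (by omega)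
  have h2 : t + 1 - 2 = t - 1 := by omega
  rw [Iterates.xund, h1, smul_smul, mul_inv_cancel₀ (by linarith), one_smul, Iterates.xtil,
    hst.theta_eq (t + 1) (by omega), h2, Nat.add_sub_cancel]

theorem wStr_mul_theta {κ : ℝ} (hκ : 0 < κ) (t : ℕ) :
    wStr κ (t + 2) * thetaStr κ = wStr κ (t + 1) := by
  have := (thetaStr_pos hκ).ne'
  unfold wStr
  rw [Nat.add_sub_cancel, show t + 2 - 1 = t + 1 from rfl, pow_succ, mul_assoc,
    one_div_mul_cancel this, mul_one]

/-- The weighted sum of the outer dual gaps. -/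
theorem outer_gap_le (h : pb.IsSmooth) (hα : 0 < α) (hL0 : 0 < L) (hL : pb.AggSmooth L)
    {M : ℕ → ℝ} (hst : IsStrStepsizes st α (L / α) Δ M) (xs : Vec n) {ph : Wt m}
    (hph : ph ∈ pb.P) (K : ℕ) :
    ∑ t ∈ Finset.range K, wStr (L / α) (t + 1) * (lin (pb.agg ph) xs (it.x (t + 1))
        - lin (pb.agg ph) (it.xund st (t + 1)) (it.x (t + 1)))
      ≤ tauStr (L / α) * (L / 2 * ‖it.x 0 - xs‖ ^ 2)
        + ∑ t ∈ Finset.range K, wStr (L / α) (t + 1) * (etaStr α (L / α) / 2)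
          * ‖it.x (t + 1) - it.x t‖ ^ 2 := by
  set κ := L / α with hκd
  have hκ : 0 < κ := div_pos hL0 hα
  have hτ := tauStr_pos hκ
  have hθ := thetaStr_pos hκ
  have hθτ : thetaStr κ * (1 + tauStr κ) = tauStr κ := by
    rw [thetaStr_eq hκ]
    field_simp
  have hη : L = etaStr α κ * (1 + tauStr κ) := by
    have h1 := tauStr_mul hκ
    have h2 : α * κ = L := by rw [hκd]; field_simp
    rw [etaStr_eq]
    linear_combination -h2 - α / 2 * h1
  have hW : ∀ t, (1 / thetaStr κ) ^ (t + 1) * thetaStr κ = wStr κ (t + 1) := fun t => by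
    unfold wStr
    rw [pow_succ, mul_assoc, one_div_mul_cancel hθ.ne', mul_one, Nat.add_sub_cancel]
  have := outer_sum_le (agg_convexOn h hph) (agg_differentiable h ph) hL0 (hL ph hph)
    (x := it.x) (xu := it.xund st) (W := fun t => (1 / thetaStr κ) ^ t * thetaStr κ) xs hτ hθτ hη
    (fun t => by
      rw [pow_succ, mul_assoc ((1 / thetaStr κ) ^ t), one_div_mul_cancel hθ.ne', mul_one])
    (fun t => by positivity) rfl (xund_succ hκ hst) K
  simp only [hW, pow_zero, one_mul, hθτ] at this
  exact this

/-- The convergence estimate of the method. -/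
theorem convergence (h : pb.IsSmooth) (hα : 0 < α) (hs : StronglyConvex α pb.u)
    (hL0 : 0 < L) (hL : pb.AggSmooth L) (hω : IsDistGen pb.P N ω) {xs : Vec n}
    (hopt : pb.IsOptimal xs) (hΔ : 0 < Δ)
    (hst : IsStrStepsizes st α (L / α) Δ (it.M pb st N)) (hg : it.IsGenerated pb st ω) {K : ℕ}
    (hK : 1 ≤ K) :
    ‖it.x K - xs‖ ^ 2 ≤ thetaStr (L / α) ^ K * ((1 + 2 * (L / α)) * ‖it.x 0 - xs‖ ^ 2
      + 4 * radius pb.P ω ^ 2 / (α * etaStr α (L / α) * Δ)) := by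
  have hout := fun {ph : Wt m} (hph : ph ∈ pb.P) =>
    outer_gap_le (it := it) h hα hL0 hL hst xs hph K
  set κ := L / α with hκd
  have hκ : 0 < κ := div_pos hL0 hα
  have hLκ : L = α * κ := by rw [hκd]; field_simp
  obtain ⟨hxs, Fs, hFs, hmin⟩ := exists_optimal_value_lin h hL hopt
  set η := etaStr α κ with hη
  set D := radius pb.P ω
  have hτ := tauStr_pos hκ
  have hθ := thetaStr_pos hκ
  have hητ : η = α * tauStr κ / 2 := etaStr_eq
  have hη0 : 0 < η := by rw [hητ]; positivity
  have hηθ : η = (η + α / 2) * thetaStr κ := by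
    rw [thetaStr_eq hκ, hητ]
    field_simp
    ring
  set w := wStr κ with hw
  have hwpos : ∀ t, 0 < w t := wStr_pos hκ
  have hw1 : w 1 = 1 := by simp [hw, wStr]
  set R := tauStr κ * (L / 2 * ‖it.x 0 - xs‖ ^ 2) + η / 2 * ‖it.x 0 - xs‖ ^ 2
    + 2 * D ^ 2 / (α * Δ) - w (K + 1) * η / 2 * ‖it.x K - xs‖ ^ 2 with hR
  set Q := ∑ t ∈ Finset.range K, w (t + 1) with hQ
  have hQpos : 0 < Q := Finset.sum_pos (fun t _ => hwpos _) (Finset.nonempty_range_iff.2 (by omega))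
  -- the gap function is bounded for every weight vector
  have hgap : ∀ ph ∈ finDom pb.P pb.rho, ∑ t ∈ Finset.range K, w (t + 1) *
      (lin (pb.agg ph) xs (it.x (t + 1)) - (pb.rho ph).toReal
        + (pb.u (it.x (t + 1))).toReal - Fs) ≤ R := by
    intro ph hph
    have h1 := hout hph.1
    have h2 : ∀ t ∈ Finset.range K, w (t + 1) *
          (lin (pb.agg ph) (it.xund st (t + 1)) (it.x (t + 1)) - (pb.rho ph).toReal
            + (pb.u (it.x (t + 1))).toReal - Fs)
          + w (t + 1) * (η / 2) * ‖it.x (t + 1) - it.x t‖ ^ 2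
        ≤ 4 / (α * Δ) * (bregman pb.P ω ph (it.p (t + 1) 0) - bregman pb.P ω ph (it.p (t + 1 + 1) 0))
          - (w (t + 1 + 1) * η / 2 * ‖it.x (t + 1) - xs‖ ^ 2
            - w (t + 1) * η / 2 * ‖it.x t - xs‖ ^ 2) := by
      intro t _
      have h3 := phase_le h hα hs hω hκ hΔ hst hg hxs hFs (t := t + 1) (by omega) hph
      rw [← hg.p_next (t + 1) (by omega), Nat.add_sub_cancel, norm_sub_rev xs] at h3
      have h4 : w (t + 1 + 1) * η = w (t + 1) * (η + α / 2) := by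
        rw [hw, ← wStr_mul_theta hκ t, mul_assoc]
        nth_rewrite 1 [hηθ]
        ring
      rw [h4]
      linarith
    have h3 := Finset.sum_le_sum h2
    rw [Finset.sum_add_distrib, Finset.sum_sub_distrib, ← Finset.mul_sum,
      Finset.sum_range_sub' (fun t => bregman pb.P ω ph (it.p (t + 1) 0)),
      Finset.sum_range_sub (fun t => w (t + 1) * η / 2 * ‖it.x t - xs‖ ^ 2)] at h3
    simp only [Nat.zero_add, hw1] at h3
    have h4 : bregman pb.P ω ph (it.p 1 0) - bregman pb.P ω ph (it.p (K + 1) 0) ≤ D ^ 2 / 2 := by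
      have h5 := bregman_le_radius hω hph.1 (p_zero_mem hst hg (t := 1) le_rfl)
      have h6 := bregman_nonneg hω hph.1 (p_zero_mem hst hg (t := K + 1) (by omega))
      linarith
    have h5 := mul_le_mul_of_nonneg_left h4 (by positivity : 0 ≤ 4 / (α * Δ))
    have h6 : 4 / (α * Δ) * (D ^ 2 / 2) = 2 * D ^ 2 / (α * Δ) := by ring
    have h7 : ∑ t ∈ Finset.range K, w (t + 1) *
        (lin (pb.agg ph) xs (it.x (t + 1)) - (pb.rho ph).toReal
          + (pb.u (it.x (t + 1))).toReal - Fs)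
        = ∑ t ∈ Finset.range K, w (t + 1) * (lin (pb.agg ph) xs (it.x (t + 1))
          - lin (pb.agg ph) (it.xund st (t + 1)) (it.x (t + 1)))
        + ∑ t ∈ Finset.range K, w (t + 1) *
          (lin (pb.agg ph) (it.xund st (t + 1)) (it.x (t + 1)) - (pb.rho ph).toReal
            + (pb.u (it.x (t + 1))).toReal - Fs) := by
      rw [← Finset.sum_add_distrib]
      exact Finset.sum_congr rfl fun t _ => by ring
    rw [h7]
    linarith
  -- evaluate the linearized objective at the weighted average
  have hxD : ∀ t ∈ Finset.range K, it.x (t + 1) ∈ finDom pb.X pb.u := fun t _ =>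
    x_mem h hs hst hg (by omega)
  have huc := u_toReal_convexOn h
  have hbar := huc.1.centerMass_mem (fun t _ => (hwpos (t + 1)).le) hQpos hxD
  have hR0 : Fs ≤ Fs + R / Q := by
    refine hmin _ hbar _ fun ph hph => ?_
    have hJ := jensen_sum (convexOn_inner_add_sq huc (gradient (pb.agg ph) xs) 0 0 le_rfl le_rfl)
      (fun t _ => (hwpos (t + 1)).le) hQpos hxD
    have h1 := hgap ph hph
    have h2 : ∑ t ∈ Finset.range K, w (t + 1) *
        (lin (pb.agg ph) xs (it.x (t + 1)) - (pb.rho ph).toReal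
          + (pb.u (it.x (t + 1))).toReal - Fs)
        = ∑ t ∈ Finset.range K, w (t + 1) * (inner ℝ (gradient (pb.agg ph) xs) (it.x (t + 1))
          + (pb.u (it.x (t + 1))).toReal + 0 * ‖it.x (t + 1) - 0‖ ^ 2
          + 0 * ‖it.x (t + 1) - 0‖ ^ 2)
          + Q * (pb.agg ph xs - inner ℝ (gradient (pb.agg ph) xs) xs
            - (pb.rho ph).toReal - Fs) := by
      rw [hQ, Finset.sum_mul, ← Finset.sum_add_distrib]
      refine Finset.sum_congr rfl fun t _ => ?_
      unfold lin
      rw [inner_sub_right]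
      ring
    rw [h2] at h1
    have h3 : Finset.centerMass (Finset.range K) (fun t => w (t + 1)) (fun t => it.x (t + 1))
      = Q⁻¹ • ∑ t ∈ Finset.range K, w (t + 1) • it.x (t + 1) := rfl
    rw [h3]
    set xb := Q⁻¹ • ∑ t ∈ Finset.range K, w (t + 1) • it.x (t + 1)
    have h4 : Q * (lin (pb.agg ph) xs xb - (pb.rho ph).toReal + (pb.u xb).toReal - Fs) ≤ R := by
      refine le_trans ?_ h1
      unfold lin
      rw [inner_sub_right]
      linarith
    rw [mul_comm, ← le_div_iff₀ hQpos] at h4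
    linarith
  have hRnn : 0 ≤ R := by
    have h1 : 0 ≤ R / Q := by linarith
    by_contra hneg
    exact absurd h1 (not_le.2 (div_neg_of_neg_of_pos (not_le.1 hneg) hQpos))
  have hwK : w (K + 1) * thetaStr κ ^ K = 1 := by
    simp only [hw, wStr, Nat.add_sub_cancel]
    rw [← mul_pow, one_div_mul_cancel hθ.ne', one_pow]
  have h8 : w (K + 1) * (η / 2) * ‖it.x K - xs‖ ^ 2
      ≤ η / 2 * ((1 + 2 * κ) * ‖it.x 0 - xs‖ ^ 2 + 4 * D ^ 2 / (α * η * Δ)) := by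
    have h9 : η / 2 * (4 * D ^ 2 / (α * η * Δ)) = 2 * D ^ 2 / (α * Δ) := by
      field_simp
      norm_num
    have h10 : tauStr κ * (L / 2) = η * κ := by
      rw [hητ, hLκ]; ring
    rw [mul_add, h9]
    have h11 : tauStr κ * (L / 2 * ‖it.x 0 - xs‖ ^ 2) = η * κ * ‖it.x 0 - xs‖ ^ 2 := by
      rw [← h10]; ring
    rw [h11] at hR
    linarith
  have h9 := mul_le_mul_of_nonneg_left h8 (by positivity : 0 ≤ thetaStr κ ^ K)
  have h10 : thetaStr κ ^ K * (w (K + 1) * (η / 2) * ‖it.x K - xs‖ ^ 2)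
      = η / 2 * ‖it.x K - xs‖ ^ 2 := by
    linear_combination (η / 2 * ‖it.x K - xs‖ ^ 2) * hwK
  rw [h10, mul_left_comm] at h9
  exact le_of_mul_le_mul_left h9 (by positivity)

/-- The operator norms encountered by the method are bounded. -/
theorem exists_M_le (h : pb.IsSmooth) (hα : 0 < α) (hs : StronglyConvex α pb.u)
    (hL0 : 0 < L) (hL : pb.AggSmooth L) (hω : IsDistGen pb.P N ω) {xs : Vec n}
    (hopt : pb.IsOptimal xs) (hΔ : 0 < Δ)
    (hst : IsStrStepsizes st α (L / α) Δ (it.M pb st N)) (hg : it.IsGenerated pb st ω) :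
    ∃ Mtil : ℝ, ∀ t : ℕ, 1 ≤ t → it.M pb st N t ≤ Mtil := by
  have hconv := fun {K : ℕ} (hK : 1 ≤ K) =>
    convergence h hα hs hL0 hL hω hopt hΔ hst hg hK
  set κ := L / α with hκd
  have hκ : 0 < κ := div_pos hL0 hα
  have hτ := tauStr_pos hκ
  have hθ := thetaStr_pos hκ
  have hθ1 := thetaStr_lt_one hκ
  set B := (1 + 2 * κ) * ‖it.x 0 - xs‖ ^ 2
    + 4 * radius pb.P ω ^ 2 / (α * etaStr α κ * Δ) with hB
  have hη : 0 < etaStr α κ := by rw [etaStr_eq]; positivity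
  have hB2 : 0 ≤ 4 * radius pb.P ω ^ 2 / (α * etaStr α κ * Δ) := by positivity
  have hB0 : 0 ≤ B := by positivity
  have hx : ∀ K, ‖it.x K - xs‖ ≤ Real.sqrt B := by
    intro K
    refine Real.le_sqrt_of_sq_le ?_
    rcases Nat.eq_zero_or_pos K with rfl | hK
    · have : 0 ≤ 2 * κ * ‖it.x 0 - xs‖ ^ 2 := by positivity
      linarith
    · exact (hconv hK).trans (mul_le_of_le_one_left hB0 (pow_le_one₀ hθ.le hθ1.le))
  set b := Real.sqrt B
  have hb0 : 0 ≤ b := Real.sqrt_nonneg B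
  have hxu : ∀ t, ‖it.xund st t - xs‖ ≤ 3 * b := by
    intro t
    induction t with
    | zero => exact (hx 0).trans (by linarith)
    | succ t ih =>
      have h1 : (1 + tauStr κ) • (it.xund st (t + 1) - xs) = (it.x t - xs)
          + thetaStr κ • ((it.x t - xs) - (it.x (t - 1) - xs))
          + tauStr κ • (it.xund st t - xs) := by
        rw [smul_sub, xund_succ hκ hst]
        module
      have h2 : ‖(1 + tauStr κ) • (it.xund st (t + 1) - xs)‖ ≤ b + 1 * (b + b)
          + tauStr κ * (3 * b) := by
        rw [h1]
        refine (norm_add_le _ _).trans (add_le_add ((norm_add_le _ _).trans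
          (add_le_add (hx t) ?_)) ?_)
        · rw [norm_smul, Real.norm_of_nonneg hθ.le]
          exact mul_le_mul hθ1.le ((norm_sub_le _ _).trans (add_le_add (hx t) (hx _)))
            (norm_nonneg _) zero_le_one
        · rw [norm_smul, Real.norm_of_nonneg hτ.le]
          exact mul_le_mul_of_nonneg_left ih hτ.le
      rw [norm_smul, Real.norm_of_nonneg (by linarith)] at h2
      have h3 : (1 + tauStr κ) * ‖it.xund st (t + 1) - xs‖ ≤ (1 + tauStr κ) * (3 * b) := by
        linarith
      exact le_of_mul_le_mul_left h3 (by linarith)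
  choose Li hLi using h.f_smooth
  obtain ⟨k, hk0, hk⟩ := exists_norm_le_mul hω.norm_def
  refine ⟨m * (k * ∑ i, (‖gradient (pb.f i) xs‖ + |Li i| * (3 * b))), fun t _ => ?_⟩
  refine opNorm_le hk0 hk fun i => ?_
  have h1 : ‖it.v pb st t i‖ ≤ ‖gradient (pb.f i) xs‖ + |Li i| * (3 * b) := by
    have h2 := norm_le_norm_add_norm_sub' (gradient (pb.f i) (it.xund st t)) (gradient (pb.f i) xs)
    have h3 := hLi i (it.xund st t) xs
    have h4 : Li i * ‖it.xund st t - xs‖ ≤ |Li i| * (3 * b) :=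
      mul_le_mul (le_abs_self _) (hxu t) (norm_nonneg _) (abs_nonneg _)
    exact h2.trans (by linarith)
  exact h1.trans (Finset.single_le_sum
    (f := fun i => ‖gradient (pb.f i) xs‖ + |Li i| * (3 * b))
    (fun j _ => by positivity) (Finset.mem_univ i))

end Main

section Complexity

theorem tauStr_bounds {κ : ℝ} (hκ : 1 ≤ κ) : 1 ≤ tauStr κ ∧ tauStr κ ≤ 2 * Real.sqrt κ := by
  have h1 : 3 ≤ Real.sqrt (8 * κ + 1) := Real.le_sqrt_of_sq_le (by linarith)
  have h2 : Real.sqrt (8 * κ + 1) ≤ 4 * Real.sqrt κ + 1 := by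
    rw [Real.sqrt_le_left (by positivity)]
    have := Real.sq_sqrt (by linarith : 0 ≤ κ)
    have := Real.sqrt_nonneg κ
    nlinarith
  unfold tauStr
  constructor <;> linarith

theorem one_sub_thetaStr {κ : ℝ} (hκ : 0 < κ) : 1 - thetaStr κ = 1 / (1 + tauStr κ) := by
  have := tauStr_pos hκ
  rw [thetaStr_eq hκ]
  field_simp
  ring

theorem geom_sum_inv_le {φ : ℝ} (h0 : 0 < φ) (k : ℕ) :
    (1 - φ) * ∑ t ∈ Finset.range (k + 1), (1 / φ) ^ t ≤ (1 / φ) ^ k := by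
  induction k with
  | zero => simp [h0.le]
  | succ k ih =>
    rw [Finset.sum_range_succ, mul_add]
    have h2 : φ * (1 / φ) ^ (k + 1) = (1 / φ) ^ k := by
      rw [pow_succ, mul_comm, mul_assoc, one_div_mul_cancel h0.ne', mul_one]
    have h3 : (1 - φ) * (1 / φ) ^ (k + 1) = (1 / φ) ^ (k + 1) - (1 / φ) ^ k := by
      rw [← h2]; ring
    linarith

/-- The number of phases is logarithmic in the accuracy. -/
theorem phases_le {κ B ε : ℝ} {k : ℕ} (hκ : 1 ≤ κ) (hε : 0 < ε) (hε2 : ε ≤ 1 / 2)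
    (hB : ε * B ≤ 5) (hk : ε < thetaStr κ ^ k * B) :
    ((k + 1 : ℕ) : ℝ) ≤ 22 * (Real.sqrt κ * Real.log (1 / ε)) := by
  have hκ0 : 0 < κ := by linarith
  have hθ := thetaStr_pos hκ0
  obtain ⟨hτ1, hτ2⟩ := tauStr_bounds hκ
  have hsq : 1 ≤ Real.sqrt κ := Real.one_le_sqrt.2 hκ
  have h2 : Real.log 2 ≤ Real.log (1 / ε) :=
    Real.log_le_log (by norm_num) (by rw [le_div_iff₀ hε]; linarith)
  have h3 := Real.log_two_gt_d9
  have h4 : ε ^ 2 < thetaStr κ ^ k * 8 := by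
    have h5 := mul_lt_mul_of_pos_left hk hε
    have h6 := mul_le_mul_of_nonneg_left hB (by positivity : 0 ≤ thetaStr κ ^ k)
    have h7 : 0 < thetaStr κ ^ k := by positivity
    nlinarith
  have h5 := Real.log_lt_log (by positivity) h4
  rw [Real.log_mul (by positivity) (by norm_num), Real.log_pow, Real.log_pow,
    show (8 : ℝ) = 2 ^ 3 by norm_num, Real.log_pow] at h5
  have h6 : Real.log ε = -Real.log (1 / ε) := by rw [one_div, Real.log_inv, neg_neg]
  have h7 := Real.log_le_sub_one_of_pos hθ
  have h8 := one_sub_thetaStr hκ0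
  have h9 : 1 / (2 * tauStr κ) ≤ 1 / (1 + tauStr κ) :=
    one_div_le_one_div_of_le (by linarith) (by linarith)
  have h10 : (k : ℝ) * (1 / (2 * tauStr κ)) ≤ k * (-Real.log (thetaStr κ)) :=
    mul_le_mul_of_nonneg_left (by linarith) (by positivity)
  set l := Real.log (1 / ε)
  rw [h6] at h5
  push_cast at h5
  have h11 : (k : ℝ) * (1 / (2 * tauStr κ)) ≤ 5 * l := by linarith
  rw [mul_one_div, div_le_iff₀ (by linarith)] at h11
  have hl : 1 / 2 ≤ l := by linarith
  push_cast
  have h12 : tauStr κ * l ≤ 2 * Real.sqrt κ * l := mul_le_mul_of_nonneg_right hτ2 (by linarith)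
  have h13 : l ≤ Real.sqrt κ * l := le_mul_of_one_le_left (by linarith) hsq
  linarith

/-- The total of the non-constant parts of the inner iteration numbers. -/
theorem sqrt_weights_sum_le {α κ Δ D R₀ ε : ℝ} {k : ℕ} (hα : 0 < α) (hκ : 1 ≤ κ)
    (hD : 0 < D) (hR : 0 < R₀) (hε : 0 < ε)
    (hΔ : Δ = 2 * D ^ 2 / (etaStr α κ * (α * κ) * R₀ ^ 2))
    (hk : ε < thetaStr κ ^ k * (5 * (κ * R₀ ^ 2))) :
    ∑ t ∈ Finset.range (k + 1), Real.sqrt (2 * wStr κ (t + 1) * Δ)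
      ≤ 36 * (κ ^ (1 / 4 : ℝ) * D / (α * Real.sqrt ε)) := by
  have hκ0 : 0 < κ := by linarith
  have hθ := thetaStr_pos hκ0
  have hθ1 := thetaStr_lt_one hκ0
  obtain ⟨hτ1, hτ2⟩ := tauStr_bounds hκ
  have hτ0 : 0 < tauStr κ := by linarith
  have hη : etaStr α κ = α * tauStr κ / 2 := etaStr_eq
  have hΔ0 : 0 < Δ := by rw [hΔ, hη]; positivity
  set θ := thetaStr κ with hθd
  set τ := tauStr κ with hτd
  set φ := Real.sqrt θ with hφ
  have hφ0 : 0 < φ := Real.sqrt_pos.2 hθ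
  have hφ1 : φ < 1 := by
    rw [hφ, Real.sqrt_lt' one_pos]
    linarith
  have hφ2 : φ ^ 2 = θ := Real.sq_sqrt hθ.le
  have hterm : ∀ t, Real.sqrt (2 * wStr κ (t + 1) * Δ) = Real.sqrt (2 * Δ) * (1 / φ) ^ t := by
    intro t
    have h1 : 2 * wStr κ (t + 1) * Δ = (2 * Δ) * ((1 / φ) ^ t) ^ 2 := by
      unfold wStr
      rw [← hθd, ← hφ2, Nat.add_sub_cancel, ← pow_mul, mul_comm t 2, pow_mul, one_div_pow]
      ring
    rw [h1, Real.sqrt_mul (by positivity), Real.sqrt_sq (by positivity)]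
  have hgeo : ∑ t ∈ Finset.range (k + 1), (1 / φ) ^ t ≤ 4 * τ * (1 / φ) ^ k := by
    have h1 := geom_sum_inv_le hφ0 k
    have h2 : 1 / (4 * τ) ≤ 1 - φ := by
      have h3 : 1 - θ = 1 / (1 + τ) := one_sub_thetaStr hκ0
      have h4 : 1 / (2 * τ) ≤ 1 / (1 + τ) :=
        one_div_le_one_div_of_le (by linarith) (by linarith)
      have h5 : 1 / (4 * τ) = 1 / (2 * τ) / 2 := by field_simp; norm_num
      rw [h5]
      nlinarith
    have h3 : 0 ≤ ∑ t ∈ Finset.range (k + 1), (1 / φ) ^ t :=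
      Finset.sum_nonneg fun t _ => by positivity
    have h4 := (mul_le_mul_of_nonneg_right h2 h3).trans h1
    rw [one_div_mul_eq_div, div_le_iff₀ (by positivity)] at h4
    linarith
  have hsum : ∑ t ∈ Finset.range (k + 1), Real.sqrt (2 * wStr κ (t + 1) * Δ)
      ≤ Real.sqrt (2 * Δ) * (4 * τ * (1 / φ) ^ k) := by
    simp only [hterm]
    rw [← Finset.mul_sum]
    exact mul_le_mul_of_nonneg_left hgeo (Real.sqrt_nonneg _)
  refine hsum.trans (le_trans (le_abs_self _) (abs_le_of_sq_le_sq ?_ (by positivity)))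
  have hpk : ((1 / φ) ^ k) ^ 2 ≤ 5 * (κ * R₀ ^ 2) / ε := by
    rw [← pow_mul, mul_comm k 2, pow_mul, one_div_pow, hφ2, one_div_pow, le_div_iff₀ hε,
      one_div_mul_eq_div, div_le_iff₀ (by positivity)]
    linarith
  have hq : (κ ^ (1 / 4 : ℝ)) ^ 2 = Real.sqrt κ := by
    rw [← Real.rpow_natCast, ← Real.rpow_mul hκ0.le, Real.sqrt_eq_rpow]
    norm_num
  have hrhs : (36 * (κ ^ (1 / 4 : ℝ) * D / (α * Real.sqrt ε))) ^ 2
      = 1296 * (Real.sqrt κ * D ^ 2 / (α ^ 2 * ε)) := by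
    rw [mul_pow, div_pow, mul_pow, mul_pow, hq, Real.sq_sqrt hε.le]
    norm_num
  have hlhs : (Real.sqrt (2 * Δ) * (4 * τ * (1 / φ) ^ k)) ^ 2
      ≤ 2 * Δ * (16 * τ ^ 2 * (5 * (κ * R₀ ^ 2) / ε)) := by
    rw [mul_pow, Real.sq_sqrt (by positivity), mul_pow]
    refine mul_le_mul_of_nonneg_left ?_ (by positivity)
    rw [mul_pow]
    have := mul_le_mul_of_nonneg_left hpk (by positivity : 0 ≤ 16 * τ ^ 2)
    linarith
  have heq : 2 * Δ * (16 * τ ^ 2 * (5 * (κ * R₀ ^ 2) / ε)) = 640 * (τ * D ^ 2 / (α ^ 2 * ε)) := by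
    rw [hΔ, hη]
    field_simp
    norm_num
  rw [hrhs]
  refine hlhs.trans ?_
  rw [heq]
  have h5 : τ * D ^ 2 / (α ^ 2 * ε) ≤ 2 * Real.sqrt κ * D ^ 2 / (α ^ 2 * ε) := by gcongr
  have h6 : 2 * Real.sqrt κ * D ^ 2 / (α ^ 2 * ε) = 2 * (Real.sqrt κ * D ^ 2 / (α ^ 2 * ε)) := by
    ring
  have h7 : 0 ≤ Real.sqrt κ * D ^ 2 / (α ^ 2 * ε) := by positivity
  linarith

variable {n m : ℕ} {pb : RiskProblem n m} {α κ Δ : ℝ} {N : Seminorm ℝ (Wt m)}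
  {ω : Wt m → ℝ} {st : Stepsizes} {it : Iterates n m}

theorem projections_le {M : ℕ → ℝ} (hst : IsStrStepsizes st α κ Δ M)
    (hM0 : ∀ t, 1 ≤ t → 0 ≤ M t) {Mtil : ℝ} (hM : ∀ t, 1 ≤ t → M t ≤ Mtil) (K : ℕ) :
    (st.projections K : ℝ)
      ≤ K + Mtil * ∑ t ∈ Finset.range K, Real.sqrt (2 * wStr κ (t + 1) * Δ) := by
  have h1 : ∀ t ∈ Finset.range K, (st.S (t + 1) : ℝ)
      ≤ 1 + Mtil * Real.sqrt (2 * wStr κ (t + 1) * Δ) := by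
    intro t _
    have ht : 1 ≤ t + 1 := by omega
    rw [hst.S_eq (t + 1) ht, Nat.cast_max, Nat.cast_one]
    have h2 := mul_le_mul_of_nonneg_left (hM (t + 1) ht)
      (Real.sqrt_nonneg (2 * wStr κ (t + 1) * Δ))
    have h3 := mul_nonneg (Real.sqrt_nonneg (2 * wStr κ (t + 1) * Δ)) (hM0 (t + 1) ht)
    have h4 := Nat.ceil_lt_add_one h3
    refine max_le ?_ ?_ <;> linarith
  unfold Stepsizes.projections
  rw [sum_Icc_one]
  push_cast
  refine (Finset.sum_le_sum h1).trans (le_of_eq ?_)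
  rw [Finset.sum_add_distrib, Finset.mul_sum]
  simp

end Complexity

end DRAOS

end

theorem mainTheorem5 :
    ∃ C : ℝ, 0 < C ∧
    ∀ (n m : ℕ) (pb : DRAOS.RiskProblem n m) (α L Δ R₀ : ℝ)
      (N : Seminorm ℝ (DRAOS.Wt m)) (ω : DRAOS.Wt m → ℝ)
      (st : DRAOS.Stepsizes) (it : DRAOS.Iterates n m) (xstar : DRAOS.Vec n),
      pb.IsSmooth →
      0 < α → DRAOS.StronglyConvex α pb.u →
      0 < L → pb.AggSmooth L →
      DRAOS.IsDistGen pb.P N ω →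
      pb.IsOptimal xstar →
      ‖it.x 0 - xstar‖ ≤ R₀ →
      0 < Δ →
      DRAOS.IsStrStepsizes st α (L / α) Δ (it.M pb st N) →
      it.IsGenerated pb st ω →
      (∀ K : ℕ, 1 ≤ K →
        ‖it.x K - xstar‖ ^ 2 ≤ DRAOS.thetaStr (L / α) ^ K *
          ((1 + 2 * (L / α)) * ‖it.x 0 - xstar‖ ^ 2
            + 4 * DRAOS.radius pb.P ω ^ 2 / (α * DRAOS.etaStr α (L / α) * Δ))) ∧
      (∃ Mtil : ℝ, ∀ t : ℕ, 1 ≤ t → it.M pb st N t ≤ Mtil) ∧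
      (Δ = 2 * DRAOS.radius pb.P ω ^ 2 / (DRAOS.etaStr α (L / α) * L * R₀ ^ 2) →
        1 ≤ L / α →
        ∀ Mtil : ℝ, (∀ t : ℕ, 1 ≤ t → it.M pb st N t ≤ Mtil) →
        ∀ ε : ℝ, 0 < ε → ε ≤ 1 / 2 → ε * ((L / α) * R₀ ^ 2) ≤ 1 →
          ∃ K : ℕ, ‖it.x K - xstar‖ ^ 2 ≤ ε ∧
            (st.projections K : ℝ) ≤
              C * ((L / α) ^ (1 / 4 : ℝ) * Mtil * DRAOS.radius pb.P ω / (α * Real.sqrt ε)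
                + Real.sqrt (L / α) * Real.log (1 / ε))) := by
  refine ⟨36, by norm_num, fun n m pb α L Δ R₀ N ω st it xs h hα hs hL0 hL hω hopt hR hΔ hst hg =>
    ⟨fun K hK => DRAOS.convergence h hα hs hL0 hL hω hopt hΔ hst hg hK,
      DRAOS.exists_M_le h hα hs hL0 hL hω hopt hΔ hst hg, ?_⟩⟩
  intro hΔe hκ1 Mtil hMtil ε hε hε2 hεκ
  have hconv := fun {K : ℕ} (hK : 1 ≤ K) =>
    DRAOS.convergence h hα hs hL0 hL hω hopt hΔ hst hg hK
  have hLκ : L = α * (L / α) := by field_simp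
  set κ := L / α
  set D := DRAOS.radius pb.P ω
  have hκ0 : 0 < κ := by linarith
  have hθ := DRAOS.thetaStr_pos hκ0
  have hη : 0 < DRAOS.etaStr α κ := by
    rw [DRAOS.etaStr_eq]
    have := DRAOS.tauStr_pos hκ0
    positivity
  have hM0 : ∀ t, 1 ≤ t → 0 ≤ it.M pb st N t := fun t _ => DRAOS.opNorm_nonneg hω.norm_def _
  have hMt0 : 0 ≤ Mtil := (hM0 1 le_rfl).trans (hMtil 1 le_rfl)
  have hR0 : 0 < R₀ := by
    refine lt_of_le_of_ne ((norm_nonneg _).trans hR) fun hR0 => ?_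
    rw [← hR0] at hΔe
    simp at hΔe
    linarith
  have hD0 : 0 < D := by
    have hDnn : 0 ≤ D := by
      refine Real.sSup_nonneg ?_
      rintro _ ⟨p, _, q, _, rfl⟩
      exact Real.sqrt_nonneg _
    refine lt_of_le_of_ne hDnn fun hD0 => ?_
    rw [← hD0] at hΔe
    simp at hΔe
    linarith
  have hx0 : ‖it.x 0 - xs‖ ^ 2 ≤ R₀ ^ 2 := pow_le_pow_left₀ (norm_nonneg _) hR 2
  set B := 5 * (κ * R₀ ^ 2) with hB
  have hB0 : 0 < B := by positivity
  have hex : ∃ K : ℕ, DRAOS.thetaStr κ ^ K * B ≤ ε := by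
    obtain ⟨K, hK⟩ := exists_pow_lt_of_lt_one (div_pos hε hB0) (DRAOS.thetaStr_lt_one hκ0)
    exact ⟨K, ((lt_div_iff₀ hB0).1 hK).le⟩
  have hl : 0 ≤ Real.log (1 / ε) := Real.log_nonneg (by rw [le_div_iff₀ hε]; linarith)
  classical
  refine ⟨Nat.find hex, ?_, ?_⟩
  · have hK := Nat.find_spec hex
    rcases Nat.eq_zero_or_pos (Nat.find hex) with hz | hpos
    · rw [hz] at hK ⊢
      rw [pow_zero, one_mul] at hK
      nlinarith [sq_nonneg R₀]
    · refine (hconv hpos).trans (le_trans ?_ hK)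
      refine mul_le_mul_of_nonneg_left ?_ (by positivity)
      have h1 : 4 * D ^ 2 / (α * DRAOS.etaStr α κ * Δ) = 2 * (κ * R₀ ^ 2) := by
        rw [hΔe]
        nth_rewrite 1 [hLκ]
        field_simp
        norm_num
      rw [h1, hB]
      have h2 := mul_le_mul_of_nonneg_left hx0 (by positivity : 0 ≤ 1 + 2 * κ)
      have h3 := mul_le_mul_of_nonneg_right hκ1 (sq_nonneg R₀)
      linarith
  · rcases hz : Nat.find hex with _ | k
    · have : 0 ≤ κ ^ (1 / 4 : ℝ) * Mtil * D / (α * Real.sqrt ε) := by positivity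
      have h2 : 0 ≤ Real.sqrt κ * Real.log (1 / ε) := by positivity
      have h3 : (st.projections 0 : ℝ) = 0 := by simp [DRAOS.Stepsizes.projections]
      rw [h3]
      positivity
    · have hk : ε < DRAOS.thetaStr κ ^ k * B :=
        not_le.1 (Nat.find_min hex (by omega : k < Nat.find hex))
      have h1 := DRAOS.projections_le hst hM0 hMtil (k + 1)
      have h2 := DRAOS.phases_le hκ1 hε hε2 (by rw [hB]; linarith) hk
      have hΔe' : Δ = 2 * D ^ 2 / (DRAOS.etaStr α κ * (α * κ) * R₀ ^ 2) := by rw [← hLκ, hΔe]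
      have h3 := mul_le_mul_of_nonneg_left
        (DRAOS.sqrt_weights_sum_le hα hκ1 hD0 hR0 hε hΔe' hk) hMt0
      have h4 : Mtil * (36 * (κ ^ (1 / 4 : ℝ) * D / (α * Real.sqrt ε)))
          = 36 * (κ ^ (1 / 4 : ℝ) * Mtil * D / (α * Real.sqrt ε)) := by ring
      have h5 : 0 ≤ Real.sqrt κ * Real.log (1 / ε) := by positivity
      rw [h4] at h3
      linarith
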